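/- Let $L,R,\mu>0$, $\mathcal I=(0,L)$, $Q_T=(0,T)\times\mathcal I$, and let $f_0,g_0\in H^1(\mathcal I)$ be non-negative. For $\varepsilon\in(0,1]$ put $a_\varepsilon(s)=\varepsilon+\max\{0,s\}$ and $$\mathcal E(u,v)=\tfrac12\int_{\mathcal I}|\partial_xu|^2+R|\partial_x(u+v)|^2\,dx .$$ For a pair $(f,g)$ put $$H_f^\varepsilon=a_\varepsilon^3(f)\partial_x^3f+\tfrac R2\big(2a_\varepsilon^3(f)+3a_\varepsilon^2(f)a_\varepsilon(g)\big)\partial_x^3(f+g),$$ $$H_g^\varepsilon=\tfrac32a_\varepsilon^2(f)a_\varepsilon(g)\partial_x^3f+\tfrac R2\big(2\mu a_\varepsilon^3(g)+3a_\varepsilon^2(f)a_\varepsilon(g)+6a_\varepsilon(f)a_\varepsilon^2(g)\big)\partial_x^3(f+g).$$ Call $(f,g)$ an $\varepsilon$-regularized solution (with initial data $(f_0,g_0)$) if the following hold. * For all $T>0$, $f,g\in L_\infty(0,T;H^1(\mathcal I))\cap L_2(0,T;H^3(\mathcal I))\cap\bigcap_{\alpha\in[0,1/2)}C([0,T],C^\alpha(\overline{\mathcal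 I}))$ and $\partial_tf,\partial_tg\in L_2(0,T;(H^1(\mathcal I))')$. * For all $T>0$ and all $\xi\in L_2(0,T;H^1(\mathcal I))$, $\int_0^T\langle\partial_tf\,|\,\xi\rangle\,dt=\int_{Q_T}H_f^\varepsilon\,\partial_x\xi\,dx\,dt$ and $\int_0^T\langle\partial_tg\,|\,\xi\rangle\,dt=\int_{Q_T}H_g^\varepsilon\,\partial_x\xi\,dx\,dt$. * $(f,g)(0)=(f_0,g_0)$; for all $T\ge0$, $\int_{\mathcal I}f(T)\,dx=\|f_0\|_{L_1}$ and $\int_{\mathcal I}g(T)\,dx=\|g_0\|_{L_1}$; and $\partial_xf(T)=\partial_xg(T)=0$ at $x=0,L$ for almost all $T>0$. * For almost all $T>0$, $$\begin{aligned}\mathcal E(f(T),g(T))&+\int_{Q_T}a_\varepsilon(f)\Big|a_\varepsilon(f)\partial_x^3f+\tfrac R2\big(2a_\varepsilon(f)+3a_\varepsilon(g)\big)\partial_x^3(f+g)\Big|^2dx\,dt\\&+\mu R^2\int_{Q_T}a_\varepsilon^3(g)|\partial_x^3(f+g)|^2dx\,dt+\tfrac{3R^2}4\int_{Q_T}a_\varepsilon(f)a_\varepsilon^2(g)|\partial_x^3(f+g)|^2dx\,dt\le\mathcal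 E(f_0,g_0).\end{aligned}$$ Let $\varphi\in C^\infty(\mathbb R)$ be non-negative with support in $[-1,0]$ and $\int_{\mathbb R}\varphi\,dx=1$, and put $\chi_1(x)=-\int_0^x\int_s^\infty\varphi(\tau)\,d\tau\,ds$ and $\chi_\delta(x)=\delta\chi_1(x/\delta)$ for $\delta>0$. (i) There is a constant $C$, depending only on $L,R,\mu,\varphi,f_0,g_0$, such that for every $\varepsilon\in(0,1]$, every $\varepsilon$-regularized solution $(f_\varepsilon,g_\varepsilon)$ and every $T\ge0$, $$\Big|\int_{\mathcal I}\chi_{\sqrt\varepsilon}(f_\varepsilon(T))\,dx\Big|\le C\sqrt T\,\varepsilon\qquad\text{and}\qquad\Big|\int_{\mathcal I}\chi_{\sqrt\varepsilon}(g_\varepsilon(T))\,dx\Big|\le C\sqrt{T\varepsilon}.$$ (ii) Let $T>0$, let $(\varepsilon_k)_k\subset(0,1]$ with $\varepsilon_k\to0$, let $(f_{\varepsilon_k},g_{\varepsilon_k})$ be $\varepsilon_k$-regularized solutions, and let $(f,g)\in C(\overline{Q_T},\mathbb R^2)$ be such that $(f_{\varepsilon_k},g_{\varepsilon_k})\to(f,g)$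 uniformly on $\overline{Q_T}$. Then $f\ge0$ and $g\ge0$ on $\overline{Q_T}$. -/

import Mathlib

open MeasureTheory Set Filter Topology
open scoped ContDiff ENNReal

noncomputable section

namespace ThinFilm

/-- Lebesgue measure on the interval `(0, L)`. -/
abbrev vol (L : ℝ) : Measure ℝ := volume.restrict (Ioo 0 L)

/-- `v` is the weak derivative of `u` on `(0, L)`. -/
def IsWeakDeriv (L : ℝ) (u v : ℝ → ℝ) : Prop :=
  ∀ ψ : ℝ → ℝ, ContDiff ℝ ∞ ψ → HasCompactSupport ψ → tsupport ψ ⊆ Ioo 0 L →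
    ∫ x in Ioo 0 L, u x * deriv ψ x = -∫ x in Ioo 0 L, v x * ψ x

lemma integrable_mul_test {L : ℝ} (u : Lp ℝ 2 (vol L)) {ψ : ℝ → ℝ}
    (hψ : Continuous ψ) (hc : HasCompactSupport ψ) :
    Integrable (fun x => u x * ψ x) (vol L) :=
  MemLp.integrable_mul (p := 2) (q := 2) (Lp.memLp u) (hψ.memLp_of_hasCompactSupport hc)

/-- The Sobolev space `H^k(0, L)`. An element is the tuple `(u, u', …, u^(k))` of a function
`u ∈ L²(0, L)` and its weak derivatives, which all lie in `L²(0, L)`; the norm is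
`(∑ j ≤ k, ‖u^(j)‖²)^(1/2)`. -/
def H (L : ℝ) (k : ℕ) : Submodule ℝ (PiLp 2 (fun _ : Fin (k + 1) => Lp ℝ 2 (vol L))) where
  carrier := {u | ∀ j : Fin k, IsWeakDeriv L (u j.castSucc) (u j.succ)}
  zero_mem' := by
    intro j ψ _ _ _
    have h0 : (((0 : Lp ℝ 2 (vol L)) : Lp ℝ 2 (vol L)) : ℝ → ℝ) =ᵐ[vol L] 0 :=
      Lp.coeFn_zero ℝ 2 (vol L)
    have h1 : ∀ θ : ℝ → ℝ, ∫ x in Ioo 0 L, (0 : Lp ℝ 2 (vol L)) x * θ x = 0 := by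
      intro θ
      apply integral_eq_zero_of_ae
      filter_upwards [h0] with x hx
      simp only [hx, Pi.zero_apply, zero_mul]
    simp only [PiLp.zero_apply]
    rw [h1, h1, neg_zero]
  add_mem' := by
    intro u v hu hv j ψ hψ hc hs
    have key : ∀ (a b : Lp ℝ 2 (vol L)) (θ : ℝ → ℝ), Continuous θ → HasCompactSupport θ →
        ∫ x in Ioo 0 L, (a + b : Lp ℝ 2 (vol L)) x * θ x
          = (∫ x in Ioo 0 L, a x * θ x) + ∫ x in Ioo 0 L, b x * θ x := by
      intro a b θ hθ hθc
      rw [← integral_add (integrable_mul_test a hθ hθc) (integrable_mul_test b hθ hθc)]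
      apply integral_congr_ae
      filter_upwards [Lp.coeFn_add a b] with x hx
      rw [hx, Pi.add_apply, add_mul]
    simp only [PiLp.add_apply]
    rw [key _ _ _ (hψ.continuous_deriv (by simp)) hc.deriv, key _ _ _ hψ.continuous hc,
      hu j ψ hψ hc hs, hv j ψ hψ hc hs]
    ring
  smul_mem' := by
    intro c u hu j ψ hψ hc hs
    have key : ∀ (a : Lp ℝ 2 (vol L)) (θ : ℝ → ℝ),
        ∫ x in Ioo 0 L, (c • a : Lp ℝ 2 (vol L)) x * θ x
          = c * ∫ x in Ioo 0 L, a x * θ x := by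
      intro a θ
      rw [← integral_const_mul]
      apply integral_congr_ae
      filter_upwards [Lp.coeFn_smul c a] with x hx
      rw [hx, Pi.smul_apply, smul_eq_mul, mul_assoc]
    simp only [PiLp.smul_apply]
    rw [key, key, hu j ψ hψ hc hs]
    ring

lemma weakDeriv_unique {L : ℝ} (u u' v v' : Lp ℝ 2 (vol L)) (h : IsWeakDeriv L u v)
    (h' : IsWeakDeriv L u' v') (huu : u = u') : v = v' := by
  subst huu
  have hint : ∀ w : Lp ℝ 2 (vol L), Integrable w (vol L) := fun w =>
    (Lp.memLp w).integrable (by norm_num)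
  have := isOpen_Ioo.ae_eq_zero_of_integral_contDiff_smul_eq_zero (U := Ioo 0 L)
    (f := fun x => v x - v' x) (μ := vol L)
    (((hint v).sub (hint v')).locallyIntegrable.locallyIntegrableOn _) (by
      intro g hg hc hs
      have e1 := h g hg hc hs
      have e2 := h' g hg hc hs
      have : ∫ x, g x • (v x - v' x) ∂vol L
          = (∫ x, v x * g x ∂vol L) - ∫ x, v' x * g x ∂vol L := by
        rw [← integral_sub (integrable_mul_test v hg.continuous hc)
          (integrable_mul_test v' hg.continuous hc)]
        congr 1; ext x; simp; ring
      rw [this]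
      have : -∫ x, v x * g x ∂vol L = -∫ x, v' x * g x ∂vol L := by rw [← e1, ← e2]
      linarith)
  apply Lp.ext
  filter_upwards [this, ae_restrict_mem measurableSet_Ioo] with x h1 h2
  linarith [h1 h2]

lemma jet_unique {L : ℝ} {k : ℕ} (u v : H L k) (h : u.1 0 = v.1 0) : u = v := by
  have : ∀ j : ℕ, ∀ hj : j < k + 1, u.1 ⟨j, hj⟩ = v.1 ⟨j, hj⟩ := by
    intro j
    induction j with
    | zero => intro _; exact h
    | succ n ih =>
      intro hj
      exact weakDeriv_unique _ _ _ _ (u.2 ⟨n, by omega⟩) (v.2 ⟨n, by omega⟩) (ih (by omega))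
  apply Subtype.ext
  ext1
  exact this _ _

/-- `u ∈ H^k(0, L)` is the class of the function `w`. -/
def Represents {L : ℝ} {k : ℕ} (u : H L k) (w : ℝ → ℝ) : Prop :=
  (u.1 0 : ℝ → ℝ) =ᵐ[vol L] w

/-- The function `w` belongs to `H^k(0, L)`. -/
def MemH (L : ℝ) (k : ℕ) (w : ℝ → ℝ) : Prop := ∃ u : H L k, Represents u w

open Classical in
/-- The `k`-th weak derivative of a function `w ∈ H^k(0, L)` (unique almost everywhere);
zero if `w ∉ H^k(0, L)`. -/
def D (L : ℝ) (k : ℕ) (w : ℝ → ℝ) : ℝ → ℝ :=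
  if h : MemH L k w then (h.choose.1 (Fin.last k) : ℝ → ℝ) else 0

/-- `D L k w` is well defined: it is the last entry of every tuple that represents `w`. -/
lemma D_eq {L : ℝ} {k : ℕ} (u : H L k) (w : ℝ → ℝ) (h : Represents u w) :
    D L k w = u.1 (Fin.last k) := by
  have hm : MemH L k w := ⟨u, h⟩
  have : hm.choose = u := jet_unique _ _ (Lp.ext (hm.choose_spec.trans h.symm))
  rw [D, dif_pos hm, this]

/-- `f ∈ L_p(0, T; H^k(0, L))` (Bochner space). -/
def MemLpH (L T : ℝ) (p : ℝ≥0∞) (k : ℕ) (f : ℝ → ℝ → ℝ) : Prop :=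
  ∃ u : ℝ → H L k, MemLp u p (vol T) ∧ ∀ᵐ t ∂vol T, Represents (u t) (f t)

/-- `f ∈ C([0, T], C^α([0, L]))`, where `C^α` carries the norm
`sup |w| + sup |w x - w y| / |x - y|^α` and consists of continuous functions. -/
def ContIntoHolder (L T α : ℝ) (f : ℝ → ℝ → ℝ) : Prop :=
  (∀ t ∈ Icc 0 T, ContinuousOn (f t) (Icc 0 L) ∧
    ∃ K : ℝ, ∀ x ∈ Icc 0 L, ∀ y ∈ Icc 0 L, |f t x - f t y| ≤ K * |x - y| ^ α) ∧
  ∀ t ∈ Icc 0 T, ∀ η > 0, ∃ ρ > 0, ∀ s ∈ Icc 0 T, |s - t| < ρ →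
    (∀ x ∈ Icc 0 L, |f s x - f t x| ≤ η) ∧
    ∀ x ∈ Icc 0 L, ∀ y ∈ Icc 0 L, |(f s x - f t x) - (f s y - f t y)| ≤ η * |x - y| ^ α

/-- `ft` is the distributional time derivative of `f` on `(0, T)`, as a function with values in
the dual of `H^1(0, L)`, into which `L²(0, L)` is embedded by the `L²` pairing. -/
def IsTimeDeriv (L T : ℝ) (f : ℝ → ℝ → ℝ) (ft : ℝ → StrongDual ℝ (H L 1)) : Prop :=
  ∀ w : H L 1, ∀ η : ℝ → ℝ, ContDiff ℝ ∞ η → HasCompactSupport η → tsupport η ⊆ Ioo 0 T →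
    ∫ t in Ioo 0 T, deriv η t * ∫ x in Ioo 0 L, f t x * w.1 0 x
      = -∫ t in Ioo 0 T, η t * ft t w

/-- `∂_t f ∈ L₂(0, T; (H^1)')` and `∫_0^T ⟨∂_t f | ξ⟩ dt = ∫_{Q_T} J ∂_x ξ dx dt` for all
`ξ ∈ L₂(0, T; H^1(0, L))`. -/
def WeakEquation (L T : ℝ) (f J : ℝ → ℝ → ℝ) : Prop :=
  ∃ ft : ℝ → StrongDual ℝ (H L 1), MemLp ft 2 (vol T) ∧ IsTimeDeriv L T f ft ∧
    ∀ ξ : ℝ → H L 1, MemLp ξ 2 (vol T) →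
      ∫ t in Ioo 0 T, ft t (ξ t) = ∫ t in Ioo 0 T, ∫ x in Ioo 0 L, J t x * (ξ t).1 1 x

/-- `a_ε(s) = ε + max {0, s}`. -/
def a (ε s : ℝ) : ℝ := ε + max 0 s

/-- The flux in the first regularized equation. -/
def fluxF (L R ε : ℝ) (f g : ℝ → ℝ → ℝ) (t x : ℝ) : ℝ :=
  a ε (f t x) ^ 3 * D L 3 (f t) x
    + R / 2 * (2 * a ε (f t x) ^ 3 + 3 * a ε (f t x) ^ 2 * a ε (g t x))
      * (D L 3 (f t) x + D L 3 (g t) x)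

/-- The flux in the second regularized equation. -/
def fluxG (L R μ ε : ℝ) (f g : ℝ → ℝ → ℝ) (t x : ℝ) : ℝ :=
  3 / 2 * a ε (f t x) ^ 2 * a ε (g t x) * D L 3 (f t) x
    + R / 2 * (2 * μ * a ε (g t x) ^ 3 + 3 * a ε (f t x) ^ 2 * a ε (g t x)
        + 6 * a ε (f t x) * a ε (g t x) ^ 2)
      * (D L 3 (f t) x + D L 3 (g t) x)

/-- The energy `1/2 ∫ |∂_x u|² + R |∂_x (u + v)|² dx`. -/
def energy (L R : ℝ) (u v : ℝ → ℝ) : ℝ :=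
  1 / 2 * ∫ x in Ioo 0 L, (D L 1 u x ^ 2 + R * (D L 1 u x + D L 1 v x) ^ 2)

/-- The dissipation of the energy at time `t` along the regularized system. -/
def dissipation (L R μ ε : ℝ) (f g : ℝ → ℝ → ℝ) (t : ℝ) : ℝ :=
  (∫ x in Ioo 0 L, a ε (f t x) * (a ε (f t x) * D L 3 (f t) x
      + R / 2 * (2 * a ε (f t x) + 3 * a ε (g t x)) * (D L 3 (f t) x + D L 3 (g t) x)) ^ 2)
    + μ * R ^ 2 * (∫ x in Ioo 0 L, a ε (g t x) ^ 3 * (D L 3 (f t) x + D L 3 (g t) x) ^ 2)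
    + 3 * R ^ 2 / 4 * (∫ x in Ioo 0 L, a ε (f t x) * a ε (g t x) ^ 2
      * (D L 3 (f t) x + D L 3 (g t) x) ^ 2)

/-- `w ∈ L_∞(0, T; H^1) ∩ L₂(0, T; H^3) ∩ ⋂_{α ∈ [0, 1/2)} C([0, T], C^α)` for all `T > 0`. -/
structure IsRegular (L : ℝ) (w : ℝ → ℝ → ℝ) : Prop where
  memLinfty : ∀ T > 0, MemLpH L T ∞ 1 w
  memL2 : ∀ T > 0, MemLpH L T 2 3 w
  holder : ∀ T > 0, ∀ α : ℝ, 0 ≤ α → α < 1 / 2 → ContIntoHolder L T α w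

/-- `(f, g)` is a global weak solution of the regularized system with parameter `ε` and initial
data `(f₀, g₀)`. Only the values at `t ≥ 0` and `x ∈ [0, L]` matter. -/
structure IsRegularizedSolution (L R μ ε : ℝ) (f₀ g₀ : ℝ → ℝ) (f g : ℝ → ℝ → ℝ) : Prop where
  regular_f : IsRegular L f
  regular_g : IsRegular L g
  equation_f : ∀ T > 0, WeakEquation L T f (fluxF L R ε f g)
  equation_g : ∀ T > 0, WeakEquation L T g (fluxG L R μ ε f g)
  initial_f : f 0 =ᵐ[vol L] f₀
  initial_g : g 0 =ᵐ[vol L] g₀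
  mass_f : ∀ T ≥ 0, ∫ x in Ioo 0 L, f T x = ∫ x in Ioo 0 L, |f₀ x|
  mass_g : ∀ T ≥ 0, ∫ x in Ioo 0 L, g T x = ∫ x in Ioo 0 L, |g₀ x|
  neumann : ∀ᵐ T ∂volume.restrict (Ioi (0 : ℝ)), ∀ x ∈ ({0, L} : Set ℝ),
    HasDerivWithinAt (f T) 0 (Icc 0 L) x ∧ HasDerivWithinAt (g T) 0 (Icc 0 L) x
  energy_le : ∀ᵐ T ∂volume.restrict (Ioi (0 : ℝ)),
    energy L R (f T) (g T) + ∫ t in Ioo 0 T, dissipation L R μ ε f g t ≤ energy L R f₀ g₀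

/-- `χ_δ(x) = δ χ_1(x / δ)` with `χ_1(x) = -∫_0^x ∫_s^∞ φ(τ) dτ ds`. -/
def chi (φ : ℝ → ℝ) (δ x : ℝ) : ℝ :=
  δ * -∫ s in (0 : ℝ)..(x / δ), ∫ τ in Ioi s, φ τ

end ThinFilm

end

/- Testing the equation for `h ∈ {f, g}` with `χ_δ'(h)` produces the factor `χ_δ''(h)`, which is at
most `K / δ` and vanishes where `h > 0`. Hence the flux `J` matters only where `h` is essentially
non-positive. There `a_ε(h) ≤ 2ε`, and Cauchy–Schwarz bounds `J²` by the density of the energy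
dissipation times `O(ε³)` for `f` and `O(ε²)` for `g`. With the bounds of the energy inequality on
`∂_x h` and on the dissipation, and with `δ = √ε`, this gives `∫ χ_δ(h(T)) = O(√T ε)` and
`O(√(T ε))`. Since `χ_δ(y) ≥ max (-y - δ) 0`, the negative part of `h(T)` vanishes in the limit. -/

namespace ThinFilm

lemma hasDerivAt_convolution_normed_zero {a b : ℝ} {w : ℝ → ℝ} (hw : IntegrableOn w (Ioo a b))
    (h : ∀ ψ : ℝ → ℝ, ContDiff ℝ ∞ ψ → HasCompactSupport ψ → tsupport ψ ⊆ Ioo a b →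
      ∫ x in Ioo a b, w x * deriv ψ x = 0)
    (ρ : ContDiffBump (0 : ℝ)) {z : ℝ} (hz : z ∈ Ioo (a + ρ.rOut) (b - ρ.rOut)) :
    HasDerivAt (convolution (ρ.normed volume) ((Ioo a b).indicator w) (.lsmul ℝ ℝ)) 0 z := by
  have hρ : ContDiff ℝ ∞ (ρ.normed volume) := ρ.contDiff_normed
  have hsupp : tsupport (fun x => ρ.normed volume (z - x)) = Metric.closedBall z ρ.rOut := by
    refine (tsupport_comp_eq_preimage (ρ.normed volume) (Homeomorph.subLeft z)).trans ?_
    ext x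
    simp [ρ.tsupport_normed_eq, Real.dist_eq, abs_sub_comm]
  have hzero := h (fun x => ρ.normed volume (z - x)) (hρ.comp (contDiff_const.sub contDiff_id))
    (by rw [HasCompactSupport, hsupp]; exact isCompact_closedBall z ρ.rOut)
    (by rw [hsupp, Real.closedBall_eq_Icc]
        exact Icc_subset_Ioo (by linarith [hz.1]) (by linarith [hz.2]))
  have hder := ρ.hasCompactSupport_normed.hasDerivAt_convolution_left (.lsmul ℝ ℝ)
    (hρ.of_le (by simp)) ((integrable_indicator_iff measurableSet_Ioo).2 hw).locallyIntegrable z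
  suffices hconv : convolution (deriv (ρ.normed volume)) ((Ioo a b).indicator w)
      (.lsmul ℝ ℝ) volume z = 0 by rwa [hconv] at hder
  rw [convolution_lsmul_swap, ← neg_eq_zero]
  refine Eq.trans ?_ hzero
  rw [← integral_neg, ← integral_indicator measurableSet_Ioo]
  congr with x
  by_cases hx : x ∈ Ioo a b <;> simp [hx, deriv_comp_const_sub, mul_comm]

lemma eq_of_integral_mul_deriv_eq_zero {a b : ℝ} {w : ℝ → ℝ} (hw : ContinuousOn w (Icc a b))
    (h : ∀ ψ : ℝ → ℝ, ContDiff ℝ ∞ ψ → HasCompactSupport ψ → tsupport ψ ⊆ Ioo a b →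
      ∫ x in Ioo a b, w x * deriv ψ x = 0) {x y : ℝ} (hx : x ∈ Ioo a b) (hy : y ∈ Ioo a b) :
    w x = w y := by
  have hwi : IntegrableOn w (Ioo a b) :=
    (hw.integrableOn_compact isCompact_Icc).mono_set Ioo_subset_Icc_self
  have hWi := (integrable_indicator_iff measurableSet_Ioo).2 hwi
  obtain ⟨r, -, hr, hr0⟩ := exists_seq_strictAnti_tendsto (0 : ℝ)
  let ρ : ℕ → ContDiffBump (0 : ℝ) := fun n => ⟨r n / 2, r n, half_pos (hr n), half_lt_self (hr n)⟩
  let m : ℕ → ℝ → ℝ := fun n =>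
    convolution ((ρ n).normed volume) ((Ioo a b).indicator w) (.lsmul ℝ ℝ)
  have m_tendsto {z : ℝ} (hz : z ∈ Ioo a b) : Tendsto (fun n => m n z) atTop (𝓝 (w z)) := by
    refine ContDiffBump.convolution_tendsto_right (g := fun _ => (Ioo a b).indicator w) hr0
      (.of_forall fun _ => hWi.aestronglyMeasurable) (Tendsto.comp ?_ tendsto_snd)
      tendsto_const_nhds
    refine (hw.continuousAt (Icc_mem_nhds hz.1 hz.2)).tendsto.congr' ?_
    filter_upwards [isOpen_Ioo.mem_nhds hz] with s hs using (indicator_of_mem hs w).symm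
  have m_eq : ∀ᶠ n in atTop, m n x = m n y := by
    filter_upwards [hr0.eventually_lt_const (sub_pos.2 hx.1),
      hr0.eventually_lt_const (sub_pos.2 hx.2), hr0.eventually_lt_const (sub_pos.2 hy.1),
      hr0.eventually_lt_const (sub_pos.2 hy.2)] with n h₁ h₂ h₃ h₄
    have m_deriv (z : ℝ) (hz : z ∈ Ioo (a + r n) (b - r n)) : HasDerivAt (m n) 0 z :=
      hasDerivAt_convolution_normed_zero hwi h (ρ n) hz
    refine isOpen_Ioo.is_const_of_deriv_eq_zero isPreconnected_Ioo
      (fun z hz => (m_deriv z hz).differentiableAt.differentiableWithinAt)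
      (fun z hz => (m_deriv z hz).deriv) ?_ ?_ <;> constructor <;> linarith
  exact tendsto_nhds_unique_of_eventuallyEq (m_tendsto hx) (m_tendsto hy) m_eq

lemma absolutelyContinuousOnInterval_comp_of_lipschitzWith {X Y : Type*} [PseudoMetricSpace X]
    [PseudoMetricSpace Y] {W : ℝ → X} {Θ : X → Y} {a b : ℝ} {K : NNReal} (hΘ : LipschitzWith K Θ)
    (hW : AbsolutelyContinuousOnInterval W a b) :
    AbsolutelyContinuousOnInterval (fun x => Θ (W x)) a b := by
  rw [absolutelyContinuousOnInterval_iff] at hW ⊢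
  intro ε hε
  obtain ⟨δ, hδ, h⟩ := hW (ε / (K + 1)) (by positivity)
  refine ⟨δ, hδ, fun E hE hlt => ?_⟩
  calc ∑ i ∈ Finset.range E.1, dist (Θ (W (E.2 i).1)) (Θ (W (E.2 i).2))
      ≤ ∑ i ∈ Finset.range E.1, dist (W (E.2 i).1) (W (E.2 i).2) * (K + 1) := by
        gcongr with i
        refine (hΘ.dist_le_mul _ _).trans ?_
        rw [mul_comm]
        gcongr
        exact le_add_of_nonneg_right zero_le_one
    _ < ε := by
        rw [← Finset.sum_mul, ← lt_div_iff₀ (by positivity)]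
        exact h E hE hlt

section Sobolev

variable {L : ℝ} {u u' v v' w : ℝ → ℝ} {k : ℕ}

lemma ae_mem_Ioo : ∀ᵐ x ∂vol L, x ∈ Ioo 0 L := ae_restrict_mem measurableSet_Ioo

lemma memLp_of_continuousOn {E : Type*} [NormedAddCommGroup E] {w : ℝ → E}
    (hw : ContinuousOn w (Icc 0 L)) (p : ℝ≥0∞) : MemLp w p (vol L) := by
  obtain ⟨M, hM⟩ := isCompact_Icc.exists_bound_of_continuousOn hw
  refine MemLp.of_bound ?_ M ?_
  · exact ((hw.integrableOn_compact isCompact_Icc).mono_set Ioo_subset_Icc_self).1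
  · filter_upwards [ae_mem_Ioo] with x hx using hM x (Ioo_subset_Icc_self hx)

lemma integrable_of_continuousOn (hw : ContinuousOn w (Icc 0 L)) : Integrable w (vol L) :=
  (memLp_of_continuousOn hw 1).integrable le_rfl

lemma IsWeakDeriv.congr_ae (h : IsWeakDeriv L u v) (hu : u =ᵐ[vol L] u') (hv : v =ᵐ[vol L] v') :
    IsWeakDeriv L u' v' := by
  intro ψ hψ hc hs
  calc ∫ x in Ioo 0 L, u' x * deriv ψ x
      = ∫ x in Ioo 0 L, u x * deriv ψ x := integral_congr_ae (hu.symm.mul (.refl _ (deriv ψ)))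
    _ = -∫ x in Ioo 0 L, v x * ψ x := h ψ hψ hc hs
    _ = -∫ x in Ioo 0 L, v' x * ψ x := congrArg _ (integral_congr_ae (hv.mul (.refl _ ψ)))

lemma isWeakDeriv_of_absolutelyContinuousOnInterval (hL : 0 ≤ L)
    (hu : AbsolutelyContinuousOnInterval u 0 L) : IsWeakDeriv L u (deriv u) := by
  intro ψ hψ _ hs
  have hψ_bdry : ψ 0 = 0 ∧ ψ L = 0 :=
    ⟨image_eq_zero_of_notMem_tsupport fun h => (hs h).1.false,
      image_eq_zero_of_notMem_tsupport fun h => (hs h).2.false⟩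
  have hparts := hu.integral_mul_deriv_eq_deriv_mul
    (hψ.of_le (by simp)).contDiffOn.absolutelyContinuousOnInterval
  simpa only [hψ_bdry, intervalIntegral.integral_of_le hL, integral_Ioc_eq_integral_Ioo, mul_zero,
    sub_zero, zero_sub] using hparts

lemma intervalIntegrable_of_integrable_vol (hv : Integrable v (vol L)) {x y : ℝ}
    (hx : x ∈ Icc 0 L) (hy : y ∈ Icc 0 L) : IntervalIntegrable v volume x y := by
  have h : IntervalIntegrable v volume 0 L :=
    (intervalIntegrable_iff_integrableOn_Ioo_of_le (hx.1.trans hx.2)).2 hv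
  refine h.mono_set ?_
  rw [uIcc_of_le (hx.1.trans hx.2)]
  exact uIcc_subset_Icc hx hy

lemma absolutelyContinuousOnInterval_primitive (hL : 0 ≤ L) (hv : Integrable v (vol L)) (c : ℝ) :
    AbsolutelyContinuousOnInterval (fun x => c + ∫ s in (0 : ℝ)..x, v s) 0 L :=
  (contDiffOn_const (n := 1)).absolutelyContinuousOnInterval.add
    ((intervalIntegrable_of_integrable_vol hv (left_mem_Icc.2 hL) (right_mem_Icc.2 hL))
      |>.absolutelyContinuousOnInterval_intervalIntegral left_mem_uIcc)

lemma ae_hasDerivAt_primitive (hL : 0 ≤ L) (hv : Integrable v (vol L)) (c : ℝ) :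
    ∀ᵐ x ∂vol L, HasDerivAt (fun x => c + ∫ s in (0 : ℝ)..x, v s) (v x) x := by
  have hi := intervalIntegrable_of_integrable_vol hv (left_mem_Icc.2 hL) (right_mem_Icc.2 hL)
  filter_upwards [ae_restrict_of_ae hi.ae_hasDerivAt_integral, ae_mem_Ioo] with x hx hxL
  exact (hx (Icc_subset_uIcc (Ioo_subset_Icc_self hxL)) 0 left_mem_uIcc).const_add c

lemma isWeakDeriv_primitive (hL : 0 ≤ L) (hv : Integrable v (vol L)) (c : ℝ) :
    IsWeakDeriv L (fun x => c + ∫ s in (0 : ℝ)..x, v s) v :=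
  (isWeakDeriv_of_absolutelyContinuousOnInterval hL
    (absolutelyContinuousOnInterval_primitive hL hv c)).congr_ae .rfl
    ((ae_hasDerivAt_primitive hL hv c).mono fun _ hx => hx.deriv)

lemma IsWeakDeriv.eq_add_integral (h : IsWeakDeriv L u v) (hL : 0 < L)
    (hu : ContinuousOn u (Icc 0 L)) (hv : Integrable v (vol L)) {x : ℝ} (hx : x ∈ Icc 0 L) :
    u x = u 0 + ∫ s in (0 : ℝ)..x, v s := by
  set V : ℝ → ℝ := fun x => u 0 + ∫ s in (0 : ℝ)..x, v s with hV
  have hVc : ContinuousOn V (Icc 0 L) := by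
    simpa only [uIcc_of_le hL.le]
      using (absolutelyContinuousOnInterval_primitive hL.le hv (u 0)).continuousOn
  have hconst {y z : ℝ} (hy : y ∈ Ioo 0 L) (hz : z ∈ Ioo 0 L) : u y - V y = u z - V z := by
    refine eq_of_integral_mul_deriv_eq_zero (w := fun x => u x - V x) (hu.sub hVc) ?_ hy hz
    intro ψ hψ hc hs
    have hψ' : MemLp (deriv ψ) ∞ (vol L) :=
      memLp_of_continuousOn (hψ.continuous_deriv (by simp)).continuousOn ∞
    calc ∫ x in Ioo 0 L, (u x - V x) * deriv ψ x
        = ∫ x in Ioo 0 L, (u x * deriv ψ x - V x * deriv ψ x) := by simp only [sub_mul]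
      _ = (∫ x in Ioo 0 L, u x * deriv ψ x) - ∫ x in Ioo 0 L, V x * deriv ψ x :=
        integral_sub ((integrable_of_continuousOn hu).mul_of_top_left hψ')
          ((integrable_of_continuousOn hVc).mul_of_top_left hψ')
      _ = 0 := by
        rw [h ψ hψ hc hs, isWeakDeriv_primitive hL.le hv (u 0) ψ hψ hc hs, sub_self]
  have hmid : L / 2 ∈ Ioo 0 L := ⟨by linarith, by linarith⟩
  have heq : EqOn (fun y => u y - V y) (fun _ => u (L / 2) - V (L / 2)) (Icc 0 L) :=
    EqOn.of_subset_closure (fun y hy => hconst hy hmid) (hu.sub hVc) continuousOn_const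
      Ioo_subset_Icc_self (closure_Ioo hL.ne).ge
  have h0 : u 0 - V 0 = 0 := by simp [hV]
  exact sub_eq_zero.1 ((heq hx).trans ((heq (left_mem_Icc.2 hL.le)).symm.trans h0))

lemma IsWeakDeriv.integral_eq_sub (h : IsWeakDeriv L u v) (hL : 0 < L)
    (hu : ContinuousOn u (Icc 0 L)) (hv : Integrable v (vol L)) {x y : ℝ} (hx : x ∈ Icc 0 L)
    (hy : y ∈ Icc 0 L) : ∫ s in x..y, v s = u y - u x := by
  have h0 : (0 : ℝ) ∈ Icc 0 L := left_mem_Icc.2 hL.le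
  rw [h.eq_add_integral hL hu hv hx, h.eq_add_integral hL hu hv hy, add_sub_add_left_eq_sub,
    intervalIntegral.integral_interval_sub_left (intervalIntegrable_of_integrable_vol hv h0 hy)
      (intervalIntegrable_of_integrable_vol hv h0 hx)]

lemma IsWeakDeriv.comp (h : IsWeakDeriv L u v) (hL : 0 < L) (hu : ContinuousOn u (Icc 0 L))
    (hv : Integrable v (vol L)) {Θ Θ' : ℝ → ℝ} (hΘ : ∀ y, HasDerivAt Θ (Θ' y) y) {K : ℝ}
    (hK : ∀ y, |Θ' y| ≤ K) : IsWeakDeriv L (fun x => Θ (u x)) (fun x => Θ' (u x) * v x) := by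
  have hlip : LipschitzWith ⟨K, (abs_nonneg _).trans (hK 0)⟩ Θ :=
    lipschitzWith_of_nnnorm_deriv_le (fun y => (hΘ y).differentiableAt) fun y => by
      rw [(hΘ y).deriv]
      exact hK y
  have hac := absolutelyContinuousOnInterval_comp_of_lipschitzWith hlip
    (absolutelyContinuousOnInterval_primitive hL.le hv (u 0))
  refine (isWeakDeriv_of_absolutelyContinuousOnInterval hL.le hac).congr_ae ?_ ?_
  · filter_upwards [ae_mem_Ioo] with x hx
    rw [h.eq_add_integral hL hu hv (Ioo_subset_Icc_self hx)]
  · filter_upwards [ae_mem_Ioo, ae_hasDerivAt_primitive hL.le hv (u 0)] with x hx hder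
    rw [h.eq_add_integral hL hu hv (Ioo_subset_Icc_self hx)]
    exact ((hΘ _).comp x hder).deriv

lemma MemH.memLp_D (h : MemH L k w) : MemLp (D L k w) 2 (vol L) := by
  obtain ⟨z, hz⟩ := h
  rw [D_eq z w hz]
  exact Lp.memLp _

lemma MemH.isWeakDeriv_D (h : MemH L 1 w) : IsWeakDeriv L w (D L 1 w) := by
  obtain ⟨z, hz⟩ := h
  rw [D_eq z w hz]
  exact IsWeakDeriv.congr_ae (z.2 0) hz .rfl

lemma IsWeakDeriv.exists_mem_H (h : IsWeakDeriv L u v) (hu : MemLp u 2 (vol L))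
    (hv : MemLp v 2 (vol L)) : ∃ z : H L 1, Represents z u ∧ z.1 1 =ᵐ[vol L] v := by
  refine ⟨⟨WithLp.toLp 2 ![hu.toLp u, hv.toLp v], fun j => ?_⟩, hu.coeFn_toLp, hv.coeFn_toLp⟩
  rw [Subsingleton.elim j 0]
  exact h.congr_ae hu.coeFn_toLp.symm hv.coeFn_toLp.symm

end Sobolev

section CauchySchwarz

variable {α : Type*} [MeasurableSpace α] {ν : Measure α}

lemma integral_abs_mul_abs_le {u v : α → ℝ} (hu : MemLp u 2 ν) (hv : MemLp v 2 ν) :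
    ∫ x, |u x| * |v x| ∂ν ≤ √(∫ x, u x ^ 2 ∂ν) * √(∫ x, v x ^ 2 ∂ν) := by
  have hoelder := integral_mul_le_Lp_mul_Lq_of_nonneg (μ := ν) Real.HolderConjugate.two_two
    (.of_forall fun x => abs_nonneg (u x)) (.of_forall fun x => abs_nonneg (v x))
    (by simpa using hu.norm) (by simpa using hv.norm)
  simpa only [Real.rpow_two, sq_abs, ← Real.sqrt_eq_rpow] using hoelder

lemma memLp_two_sqrt {p : α → ℝ} (hp : Integrable p ν) (hp0 : 0 ≤ᵐ[ν] p) :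
    MemLp (fun x => √(p x)) 2 ν := by
  rw [memLp_two_iff_integrable_sq hp.aestronglyMeasurable.aemeasurable.sqrt.aestronglyMeasurable]
  exact hp.congr (hp0.mono fun x hx => (Real.sq_sqrt hx).symm)

lemma integral_sqrt_mul_abs_le {p v : α → ℝ} (hp : Integrable p ν) (hp0 : 0 ≤ᵐ[ν] p)
    (hv : MemLp v 2 ν) :
    ∫ x, √(p x) * |v x| ∂ν ≤ √(∫ x, p x ∂ν) * √(∫ x, v x ^ 2 ∂ν) := by
  calc ∫ x, √(p x) * |v x| ∂ν = ∫ x, |√(p x)| * |v x| ∂ν := by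
        simp only [abs_of_nonneg (Real.sqrt_nonneg _)]
    _ ≤ √(∫ x, √(p x) ^ 2 ∂ν) * √(∫ x, v x ^ 2 ∂ν) :=
        integral_abs_mul_abs_le (memLp_two_sqrt hp hp0) hv
    _ = √(∫ x, p x ∂ν) * √(∫ x, v x ^ 2 ∂ν) := by
        rw [integral_congr_ae (hp0.mono fun x hx => Real.sq_sqrt hx)]

end CauchySchwarz

section SpaceTime

variable {L T : ℝ} {h J : ℝ → ℝ → ℝ}

lemma setIntegral_abs_le_of_sq {v : ℝ → ℝ} {M : ℝ} (hL : 0 ≤ L) (hM : 0 ≤ M)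
    (hv : MemLp v 2 (vol L)) (hvM : ∫ x in Ioo 0 L, v x ^ 2 ≤ M ^ 2) :
    ∫ x in Ioo 0 L, |v x| ≤ √L * M := by
  calc ∫ x in Ioo 0 L, |v x| ≤ √(∫ _ in Ioo 0 L, 1) * √(∫ x in Ioo 0 L, v x ^ 2) := by
        simpa using integral_sqrt_mul_abs_le (p := fun _ => 1) (integrable_const _)
          (.of_forall fun _ => zero_le_one) hv
    _ = √L * √(∫ x in Ioo 0 L, v x ^ 2) := by simp [hL]
    _ ≤ √L * M := by gcongr; exact (Real.sqrt_le_left hM).2 hvM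

lemma MemH.le_of_integral_sq_D_le {w : ℝ → ℝ} {m M : ℝ} (hw : MemH L 1 w) (hL : 0 < L)
    (hwc : ContinuousOn w (Icc 0 L)) (hM : 0 ≤ M) (hwM : ∫ x in Ioo 0 L, D L 1 w x ^ 2 ≤ M ^ 2)
    (hm : ∫ x in Ioo 0 L, w x = m) {x : ℝ} (hx : x ∈ Icc 0 L) : w x ≤ m / L + √L * M := by
  obtain ⟨y, hy, hwy⟩ := exists_eq_interval_average hL.ne (f := w) (by rwa [uIcc_of_le hL.le])
  replace hy : y ∈ Icc 0 L := Ioo_subset_Icc_self (by rwa [uIoo_of_le hL.le] at hy)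
  replace hwy : w y = m / L := by
    rw [hwy, interval_average_eq_div, intervalIntegral.integral_of_le hL.le,
      integral_Ioc_eq_integral_Ioo, hm, sub_zero]
  have hi : Integrable (D L 1 w) (vol L) := hw.memLp_D.integrable one_le_two
  have hosc : w x - w y ≤ √L * M := by
    rw [← hw.isWeakDeriv_D.integral_eq_sub hL hwc hi hy hx]
    refine (Real.le_norm_self _).trans <|
      intervalIntegral.norm_integral_le_integral_norm_uIoc.trans <|
      le_trans ?_ (setIntegral_abs_le_of_sq hL.le hM hw.memLp_D hwM)
    rw [← integral_Ioc_eq_integral_Ioo]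
    exact setIntegral_mono_set (integrableOn_Ioc_iff_integrableOn_Ioo (by simp) |>.2 hi.norm)
      (.of_forall fun _ => norm_nonneg _)
      (Ioc_subset_Ioc (le_min hy.1 hx.1) (max_le hy.2 hx.2)).eventuallyLE
  linarith

lemma ContIntoHolder.continuousOn {α : ℝ} (hh : ContIntoHolder L T α h) :
    ContinuousOn (fun p : ℝ × ℝ => h p.1 p.2) (Icc 0 T ×ˢ Icc 0 L) := by
  rintro ⟨t, x⟩ ⟨ht, hx⟩
  rw [Metric.continuousWithinAt_iff]
  intro η hη
  obtain ⟨ρ, hρ, htime⟩ := hh.2 t ht (η / 2) (half_pos hη)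
  obtain ⟨σ, hσ, hspace⟩ :=
    Metric.continuousWithinAt_iff.1 ((hh.1 t ht).1 x hx) (η / 2) (half_pos hη)
  refine ⟨min ρ σ, lt_min hρ hσ, ?_⟩
  rintro ⟨s, y⟩ ⟨hs, hy⟩ hd
  rw [Prod.dist_eq, max_lt_iff] at hd
  calc dist (h s y) (h t x) ≤ dist (h s y) (h t y) + dist (h t y) (h t x) := dist_triangle ..
    _ < η / 2 + η / 2 := add_lt_add_of_le_of_lt
        ((htime s hs (hd.1.trans_le (min_le_left ..))).1 y hy)
        (hspace hy (hd.2.trans_le (min_le_right ..)))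
    _ = η := add_halves η

lemma continuousOn_slice
    (hh : ContinuousOn (fun p : ℝ × ℝ => h p.1 p.2) (Icc 0 T ×ˢ Icc 0 L)) {t : ℝ}
    (ht : t ∈ Icc 0 T) : ContinuousOn (h t) (Icc 0 L) :=
  hh.comp (f := fun x => (t, x)) (by fun_prop) fun _ hx => ⟨ht, hx⟩

lemma continuousOn_integral_mul
    (hh : ContinuousOn (fun p : ℝ × ℝ => h p.1 p.2) (Icc 0 T ×ˢ Icc 0 L)) {z : ℝ → ℝ}
    (hz : Integrable z (vol L)) :
    ContinuousOn (fun t => ∫ x in Ioo 0 L, h t x * z x) (Icc 0 T) := by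
  obtain ⟨M, hM⟩ := (isCompact_Icc.prod isCompact_Icc).exists_bound_of_continuousOn hh
  refine continuousOn_of_dominated (bound := fun x => M * ‖z x‖) ?_ ?_ (hz.norm.const_mul M) ?_
  · exact fun t ht =>
      (integrable_of_continuousOn (continuousOn_slice hh ht)).aestronglyMeasurable.mul
        hz.aestronglyMeasurable
  · intro t ht
    filter_upwards [ae_mem_Ioo] with x hx
    rw [norm_mul]
    gcongr
    exact hM (t, x) ⟨ht, Ioo_subset_Icc_self hx⟩
  · filter_upwards [ae_mem_Ioo] with x hx
    exact (hh.comp (f := fun t => (t, x)) (by fun_prop)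
      fun t ht => ⟨ht, Ioo_subset_Icc_self hx⟩).mul continuousOn_const

lemma integrable_apply_of_memLp {E α : Type*} [NormedAddCommGroup E] [NormedSpace ℝ E]
    [MeasurableSpace α] {ν : Measure α} [IsFiniteMeasure ν] {F : α → StrongDual ℝ E}
    {p : ℝ≥0∞} (hF : MemLp F p ν) (hp : 1 ≤ p) (z : E) : Integrable (fun t => F t z) ν :=
  (ContinuousLinearMap.apply ℝ ℝ z).integrable_comp (hF.integrable hp)

lemma IsTimeDeriv.integral_sub_mul {ft : ℝ → StrongDual ℝ (H L 1)} (hder : IsTimeDeriv L T h ft)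
    (hft : MemLp ft 2 (vol T))
    (hh : ContinuousOn (fun p : ℝ × ℝ => h p.1 p.2) (Icc 0 T ×ˢ Icc 0 L)) (z : H L 1)
    {t₁ t₂ : ℝ} (h₁ : t₁ ∈ Icc 0 T) (h₂ : t₂ ∈ Icc 0 T) (h₁₂ : t₁ < t₂) :
    ∫ x in Ioo 0 L, (h t₂ x - h t₁ x) * z.1 0 x = ∫ t in Ioo t₁ t₂, ft t z := by
  have hz : Integrable (z.1 0) (vol L) := (Lp.memLp (z.1 0)).integrable one_le_two
  have hfz : Integrable (fun t => ft t z) (vol T) :=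
    integrable_apply_of_memLp hft one_le_two z
  have hweak : IsWeakDeriv T (fun t => ∫ x in Ioo 0 L, h t x * z.1 0 x) (fun t => ft t z) := by
    intro η hη hc hs
    simpa only [mul_comm] using hder z η hη hc hs
  have hint {t : ℝ} (ht : t ∈ Icc 0 T) : Integrable (fun x => h t x * z.1 0 x) (vol L) :=
    hz.mul_of_top_right (memLp_of_continuousOn (continuousOn_slice hh ht) ∞)
  calc ∫ x in Ioo 0 L, (h t₂ x - h t₁ x) * z.1 0 x
      = (∫ x in Ioo 0 L, h t₂ x * z.1 0 x) - ∫ x in Ioo 0 L, h t₁ x * z.1 0 x := by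
        simp only [sub_mul]
        exact integral_sub (hint h₂) (hint h₁)
    _ = ∫ t in t₁..t₂, ft t z :=
        (hweak.integral_eq_sub (h₁.1.trans_lt (h₁₂.trans_le h₂.2)) (continuousOn_integral_mul hh hz)
          hfz h₁ h₂).symm
    _ = ∫ t in Ioo t₁ t₂, ft t z := by
        rw [intervalIntegral.integral_of_le h₁₂.le, integral_Ioc_eq_integral_Ioo]

lemma WeakEquation.integral_sub_mul (hw : WeakEquation L T h J)
    (hh : ContinuousOn (fun p : ℝ × ℝ => h p.1 p.2) (Icc 0 T ×ˢ Icc 0 L)) (z : H L 1)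
    {t₁ t₂ : ℝ} (h₁ : t₁ ∈ Icc 0 T) (h₂ : t₂ ∈ Icc 0 T) (h₁₂ : t₁ < t₂) :
    ∫ x in Ioo 0 L, (h t₂ x - h t₁ x) * z.1 0 x
      = ∫ t in Ioo t₁ t₂, ∫ x in Ioo 0 L, J t x * z.1 1 x := by
  obtain ⟨ft, hft, hder, heq⟩ := hw
  let ξ : ℝ → H L 1 := (Ioo t₁ t₂).indicator fun _ => z
  have hsub : Ioo t₁ t₂ ⊆ Ioo 0 T := Ioo_subset_Ioo h₁.1 h₂.2
  have hft_ξ : (fun t => ft t (ξ t)) = (Ioo t₁ t₂).indicator fun t => ft t z := by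
    ext t
    by_cases ht : t ∈ Ioo t₁ t₂ <;> simp [ξ, ht]
  have hJ_ξ : (fun t => ∫ x in Ioo 0 L, J t x * (ξ t).1 1 x)
      = (Ioo t₁ t₂).indicator fun t => ∫ x in Ioo 0 L, J t x * z.1 1 x := by
    ext t
    by_cases ht : t ∈ Ioo t₁ t₂
    · simp [ξ, ht]
    · have hzero : ((0 : Lp ℝ 2 (vol L)) : ℝ → ℝ) =ᵐ[vol L] 0 := Lp.coeFn_zero ..
      simp only [ξ, ht, not_false_eq_true, indicator_of_notMem]
      exact integral_eq_zero_of_ae (hzero.mono fun x hx => mul_eq_zero_of_right _ hx)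
  have htest := heq ξ ((memLp_const z).indicator measurableSet_Ioo)
  rw [hft_ξ, hJ_ξ, setIntegral_indicator measurableSet_Ioo, setIntegral_indicator measurableSet_Ioo,
    inter_eq_right.2 hsub] at htest
  rw [hder.integral_sub_mul hft hh z h₁ h₂ h₁₂, htest]

end SpaceTime

section SquareIntegrable

variable {L T : ℝ} {c w w₁ w₂ : ℝ → ℝ → ℝ}

/-- `w ∈ L₂(0, T; L₂(0, L))`, where `w t` matters only up to null sets and only for almost every
`t`. The function `D L k (f t)` is an arbitrary representative for each `t`, so that joint
measurability of `w` cannot be asked for. -/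
def MemL2L2 (L T : ℝ) (w : ℝ → ℝ → ℝ) : Prop :=
  ∃ u : ℝ → Lp ℝ 2 (vol L), MemLp u 2 (vol T) ∧ ∀ᵐ t ∂vol T, w t =ᵐ[vol L] u t

lemma MemLpH.memL2L2_D {k : ℕ} (hw : MemLpH L T 2 k w) : MemL2L2 L T fun t => D L k (w t) := by
  obtain ⟨U, hU, hrep⟩ := hw
  let top : H L k →L[ℝ] Lp ℝ 2 (vol L) :=
    PiLp.proj 2 (fun _ : Fin (k + 1) => Lp ℝ 2 (vol L)) (Fin.last k) ∘L (H L k).subtypeL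
  exact ⟨fun t => top (U t), top.comp_memLp' hU, hrep.mono fun t ht => .of_eq (D_eq _ _ ht)⟩

lemma MemL2L2.add (h₁ : MemL2L2 L T w₁) (h₂ : MemL2L2 L T w₂) :
    MemL2L2 L T fun t x => w₁ t x + w₂ t x := by
  obtain ⟨u₁, hu₁, hw₁⟩ := h₁
  obtain ⟨u₂, hu₂, hw₂⟩ := h₂
  refine ⟨fun t => u₁ t + u₂ t, hu₁.add hu₂, ?_⟩
  filter_upwards [hw₁, hw₂] with t ht₁ ht₂
  exact (ht₁.add ht₂).trans (Lp.coeFn_add ..).symm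

lemma exists_memLp_top_of_continuousOn
    (hc : ContinuousOn (fun p : ℝ × ℝ => c p.1 p.2) (Icc 0 T ×ˢ Icc 0 L)) :
    ∃ C : ℝ → Lp ℝ ∞ (vol L), MemLp C ∞ (vol T) ∧ ∀ t ∈ Icc 0 T, c t =ᵐ[vol L] C t := by
  have hmem {t : ℝ} (ht : t ∈ Icc 0 T) : MemLp (c t) ∞ (vol L) :=
    memLp_of_continuousOn (continuousOn_slice hc ht) ∞
  have hex : ∀ t, ∃ C : Lp ℝ ∞ (vol L), t ∈ Icc 0 T → c t =ᵐ[vol L] C := fun t => by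
    by_cases ht : t ∈ Icc 0 T
    · exact ⟨(hmem ht).toLp, fun _ => (hmem ht).coeFn_toLp.symm⟩
    · exact ⟨0, fun h => absurd h ht⟩
  choose C hC using hex
  refine ⟨C, memLp_of_continuousOn (Metric.continuousOn_iff.2 fun t ht η hη => ?_) ∞, hC⟩
  obtain ⟨ρ, hρ, hclose⟩ := Metric.uniformContinuousOn_iff.1
    ((isCompact_Icc.prod isCompact_Icc).uniformContinuousOn_of_continuous hc) (η / 2) (half_pos hη)
  refine ⟨ρ, hρ, fun s hs hst => (?_ : _ ≤ η / 2).trans_lt (half_lt_self hη)⟩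
  suffices ‖C s - C t‖ ≤ measureUnivNNReal (vol L) ^ (∞ : ℝ≥0∞).toReal⁻¹ * (η / 2) by
    simpa [dist_eq_norm] using this
  refine Lp.norm_le_of_ae_bound (half_pos hη).le ?_
  filter_upwards [Lp.coeFn_sub (C s) (C t), hC s hs, hC t ht, ae_mem_Ioo] with x hx hsx htx hxI
  rw [hx, Pi.sub_apply, ← hsx, ← htx, ← dist_eq_norm]
  have hxI := Ioo_subset_Icc_self hxI
  exact (hclose (s, x) ⟨hs, hxI⟩ (t, x) ⟨ht, hxI⟩ (by simpa [Prod.dist_eq, hρ] using hst)).le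

lemma MemL2L2.continuousOn_mul (hw : MemL2L2 L T w)
    (hc : ContinuousOn (fun p : ℝ × ℝ => c p.1 p.2) (Icc 0 T ×ˢ Icc 0 L)) :
    MemL2L2 L T fun t x => c t x * w t x := by
  obtain ⟨u, hu, hwu⟩ := hw
  obtain ⟨C, hC, hcC⟩ := exists_memLp_top_of_continuousOn hc
  let B := ContinuousLinearMap.mul ℝ ℝ
  refine ⟨fun t => B.holder 2 (C t) (u t), (B.holderL (vol L) ∞ 2 2).memLp_of_bilin 2 hC hu, ?_⟩
  filter_upwards [hwu, ae_mem_Ioo] with t ht htI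
  filter_upwards [ht, hcC t (Ioo_subset_Icc_self htI), B.coeFn_holder (r := 2) (C t) (u t)]
    with x hwx hcx hx
  rw [hx, hwx, hcx, ContinuousLinearMap.mul_apply']

lemma MemL2L2.ae_memLp (hw : MemL2L2 L T w) : ∀ᵐ t ∂vol T, MemLp (w t) 2 (vol L) := by
  obtain ⟨u, -, hwu⟩ := hw
  exact hwu.mono fun t ht => (Lp.memLp (u t)).ae_eq ht.symm

lemma MemL2L2.integrable_integral_sq (hw : MemL2L2 L T w) :
    Integrable (fun t => ∫ x in Ioo 0 L, w t x ^ 2) (vol T) := by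
  obtain ⟨u, hu, hwu⟩ := hw
  refine hu.integrable_norm_pow two_ne_zero |>.congr ?_
  filter_upwards [hwu] with t ht
  rw [← real_inner_self_eq_norm_sq, L2.inner_def]
  refine integral_congr_ae (ht.mono fun x hx => ?_)
  simp [hx, sq]

lemma MemL2L2.ae_integrable_mul_sq (hw : MemL2L2 L T w)
    (hc : ContinuousOn (fun p : ℝ × ℝ => c p.1 p.2) (Icc 0 T ×ˢ Icc 0 L)) :
    ∀ᵐ t ∂vol T, Integrable (fun x => c t x * w t x ^ 2) (vol L) := by
  filter_upwards [hw.ae_memLp, ae_mem_Ioo] with t hwt ht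
  exact hwt.integrable_sq.mul_of_top_right
    (memLp_of_continuousOn (continuousOn_slice hc (Ioo_subset_Icc_self ht)) ∞)

lemma MemL2L2.integrable_integral_mul_sq (hw : MemL2L2 L T w)
    (hc : ContinuousOn (fun p : ℝ × ℝ => c p.1 p.2) (Icc 0 T ×ˢ Icc 0 L))
    (hc0 : ∀ t x, 0 ≤ c t x) :
    Integrable (fun t => ∫ x in Ioo 0 L, c t x * w t x ^ 2) (vol T) := by
  simpa only [mul_pow, Real.sq_sqrt (hc0 _ _)] using
    (hw.continuousOn_mul (c := fun t x => √(c t x)) hc.sqrt).integrable_integral_sq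

end SquareIntegrable

section Dissipation

variable {L R μ ε T t x : ℝ} {f g w : ℝ → ℝ → ℝ}

/-- The factor `a_ε(f) ∂ₓ³f + R/2 (2 a_ε(f) + 3 a_ε(g)) ∂ₓ³(f + g)`, whose square appears in the
dissipation. The first flux is `a_ε(f)²` times this velocity. -/
noncomputable def velocity (L R ε : ℝ) (f g : ℝ → ℝ → ℝ) (t x : ℝ) : ℝ :=
  a ε (f t x) * D L 3 (f t) x
    + R / 2 * (2 * a ε (f t x) + 3 * a ε (g t x)) * (D L 3 (f t) x + D L 3 (g t) x)

/-- The integrand in space of the dissipation, its three terms collected in one function. -/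
noncomputable def density (L R μ ε : ℝ) (f g : ℝ → ℝ → ℝ) (t x : ℝ) : ℝ :=
  a ε (f t x) * velocity L R ε f g t x ^ 2
    + μ * R ^ 2 * (a ε (g t x) ^ 3 * (D L 3 (f t) x + D L 3 (g t) x) ^ 2)
    + 3 * R ^ 2 / 4 * (a ε (f t x) * a ε (g t x) ^ 2 * (D L 3 (f t) x + D L 3 (g t) x) ^ 2)

lemma a_nonneg (hε : 0 ≤ ε) (s : ℝ) : 0 ≤ a ε s := add_nonneg hε (le_max_left ..)

lemma continuous_a : Continuous (a ε) := by unfold a; fun_prop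

lemma a_le_two_mul (hx : x ≤ ε) (hε : 0 ≤ ε) : a ε x ≤ 2 * ε := by
  rw [a, two_mul]
  gcongr
  exact max_le hε hx

lemma density_nonneg (hμ : 0 ≤ μ) (hε : 0 ≤ ε) : 0 ≤ density L R μ ε f g t x := by
  have hf := a_nonneg hε (f t x)
  have hg := a_nonneg hε (g t x)
  rw [density]
  positivity

lemma dissipation_nonneg (hμ : 0 ≤ μ) (hε : 0 ≤ ε) : 0 ≤ dissipation L R μ ε f g t := by
  have hf x := a_nonneg hε (f t x)
  have hg x := a_nonneg hε (g t x)
  rw [dissipation]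
  refine add_nonneg (add_nonneg ?_ (mul_nonneg (by positivity) ?_))
    (mul_nonneg (by positivity) ?_)
  · exact integral_nonneg fun x => mul_nonneg (hf x) (sq_nonneg _)
  · exact integral_nonneg fun x => mul_nonneg (pow_nonneg (hg x) 3) (sq_nonneg _)
  · exact integral_nonneg fun x => mul_nonneg (mul_nonneg (hf x) (sq_nonneg _)) (sq_nonneg _)

lemma fluxF_sq_le (hμ : 0 ≤ μ) (hε : 0 ≤ ε) :
    fluxF L R ε f g t x ^ 2 ≤ a ε (f t x) ^ 3 * density L R μ ε f g t x := by
  have hf := a_nonneg hε (f t x)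
  have hg := a_nonneg hε (g t x)
  calc fluxF L R ε f g t x ^ 2
      = a ε (f t x) ^ 3 * (a ε (f t x) * velocity L R ε f g t x ^ 2) := by
        rw [fluxF, velocity]; ring
    _ ≤ a ε (f t x) ^ 3 * density L R μ ε f g t x := by
        gcongr
        rw [density, add_assoc]
        exact le_add_of_nonneg_right (by positivity)

lemma fluxG_sq_le (hμ : 0 ≤ μ) (hε : 0 ≤ ε) :
    fluxG L R μ ε f g t x ^ 2
      ≤ a ε (g t x) ^ 2 * (3 * a ε (f t x) + μ * a ε (g t x)) * density L R μ ε f g t x := by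
  have hb := a_nonneg hε (f t x)
  have hc := a_nonneg hε (g t x)
  have hfluxG : fluxG L R μ ε f g t x = 3 / 2 * a ε (f t x) * a ε (g t x) * velocity L R ε f g t x
      + μ * R * a ε (g t x) ^ 3 * (D L 3 (f t) x + D L 3 (g t) x)
      + 3 / 4 * R * a ε (f t x) * a ε (g t x) ^ 2 * (D L 3 (f t) x + D L 3 (g t) x) := by
    rw [fluxG, velocity]; ring
  rw [hfluxG, density]
  set b := a ε (f t x)
  set c := a ε (g t x)
  set y := velocity L R ε f g t x
  set q := D L 3 (f t) x + D L 3 (g t) x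
  have hcs := Finset.univ.sum_sq_le_sum_mul_sum_of_sq_le_mul (R := ℝ)
    (r := ![3 / 2 * b * c * y, μ * R * c ^ 3 * q, 3 / 4 * R * b * c ^ 2 * q])
    (f := ![9 / 4 * b * c ^ 2, μ * c ^ 3, 3 / 4 * b * c ^ 2])
    (g := ![b * y ^ 2, μ * R ^ 2 * (c ^ 3 * q ^ 2), 3 * R ^ 2 / 4 * (b * c ^ 2 * q ^ 2)])
    (fun i _ => by fin_cases i <;> dsimp <;> positivity)
    (fun i _ => by fin_cases i <;> dsimp <;> positivity)
    (fun i _ => le_of_eq (by fin_cases i <;> dsimp <;> ring))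
  simp only [Fin.sum_univ_three, Matrix.cons_val] at hcs
  refine hcs.trans_eq ?_
  ring

lemma IsRegular.continuousOn (hw : IsRegular L w) (hT : 0 < T) :
    ContinuousOn (fun p : ℝ × ℝ => w p.1 p.2) (Icc 0 T ×ˢ Icc 0 L) :=
  (hw.holder T hT 0 le_rfl one_half_pos).continuousOn

lemma IsRegular.continuousOn_a (hw : IsRegular L w) (hT : 0 < T) :
    ContinuousOn (fun p : ℝ × ℝ => a ε (w p.1 p.2)) (Icc 0 T ×ˢ Icc 0 L) :=
  continuous_a.comp_continuousOn (hw.continuousOn hT)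

lemma IsRegular.memL2L2_D_add_D (hf : IsRegular L f) (hg : IsRegular L g) (hT : 0 < T) :
    MemL2L2 L T fun t x => D L 3 (f t) x + D L 3 (g t) x :=
  (hf.memL2 T hT).memL2L2_D.add (hg.memL2 T hT).memL2L2_D

lemma IsRegular.memL2L2_velocity (hf : IsRegular L f) (hg : IsRegular L g) (hT : 0 < T) :
    MemL2L2 L T (velocity L R ε f g) := by
  have ha := hf.continuousOn_a (ε := ε) hT
  have hb := hg.continuousOn_a (ε := ε) hT
  exact ((hf.memL2 T hT).memL2L2_D.continuousOn_mul ha).add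
    ((hf.memL2L2_D_add_D hg hT).continuousOn_mul
      (c := fun t x => R / 2 * (2 * a ε (f t x) + 3 * a ε (g t x))) (by fun_prop))

lemma IsRegular.ae_integral_density (hf : IsRegular L f) (hg : IsRegular L g) (hT : 0 < T) :
    ∀ᵐ t ∂vol T, Integrable (density L R μ ε f g t) (vol L) ∧
      ∫ x in Ioo 0 L, density L R μ ε f g t x = dissipation L R μ ε f g t := by
  have ha := hf.continuousOn_a (ε := ε) hT
  have hb := hg.continuousOn_a (ε := ε) hT
  have hq := hf.memL2L2_D_add_D hg hT
  filter_upwards [(hf.memL2L2_velocity (R := R) (ε := ε) hg hT).ae_integrable_mul_sq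
      (c := fun t x => a ε (f t x)) ha,
    hq.ae_integrable_mul_sq (c := fun t x => a ε (g t x) ^ 3) (by fun_prop),
    hq.ae_integrable_mul_sq (c := fun t x => a ε (f t x) * a ε (g t x) ^ 2) (by fun_prop)]
    with t h₁ h₂ h₃
  replace h₂ := h₂.const_mul (μ * R ^ 2)
  replace h₃ := h₃.const_mul (3 * R ^ 2 / 4)
  refine ⟨(h₁.add h₂).add h₃, ?_⟩
  rw [dissipation, ← integral_const_mul, ← integral_const_mul]
  exact (integral_add (h₁.add h₂) h₃).trans (congrArg (· + _) (integral_add h₁ h₂))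

lemma IsRegular.integrable_dissipation (hf : IsRegular L f) (hg : IsRegular L g) (hT : 0 < T)
    (hε : 0 ≤ ε) : Integrable (dissipation L R μ ε f g) (vol T) := by
  have ha := hf.continuousOn_a (ε := ε) hT
  have hb := hg.continuousOn_a (ε := ε) hT
  have hf0 t x := a_nonneg hε (f t x)
  have hg0 t x := a_nonneg hε (g t x)
  have hq := hf.memL2L2_D_add_D hg hT
  exact ((hf.memL2L2_velocity hg hT).integrable_integral_mul_sq ha hf0).add
    ((hq.integrable_integral_mul_sq (c := fun t x => a ε (g t x) ^ 3) (by fun_prop)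
      fun t x => pow_nonneg (hg0 t x) 3).const_mul _) |>.add
    ((hq.integrable_integral_mul_sq (c := fun t x => a ε (f t x) * a ε (g t x) ^ 2) (by fun_prop)
      fun t x => mul_nonneg (hf0 t x) (sq_nonneg _)).const_mul _)

end Dissipation

section LocallyAntitone

variable {T ρ : ℝ} {F : ℝ → ℝ}

lemma le_of_locally_antitone (hT : 0 ≤ T) (hρ : 0 < ρ) (hF : ContinuousOn F (Icc 0 T))
    (hloc : ∀ t₁ ∈ Icc 0 T, ∀ t₂ ∈ Icc 0 T, t₁ < t₂ → t₂ - t₁ ≤ ρ → F t₂ ≤ F t₁) :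
    F T ≤ F 0 := by
  have hclosed : IsClosed ({t | F t ≤ F 0} ∩ Icc 0 T) := by
    rw [inter_comm]
    exact hF.preimage_isClosed_of_isClosed isClosed_Icc isClosed_Iic
  refine hclosed.Icc_subset_of_forall_mem_nhdsWithin (le_refl (F 0)) ?_ (right_mem_Icc.2 hT)
  rintro t ⟨ht, ht0, htT⟩
  filter_upwards [Ioo_mem_nhdsGT (lt_min htT (lt_add_of_pos_right t hρ))] with s hs
  have hs' := lt_min_iff.1 hs.2
  exact (hloc t ⟨ht0, htT.le⟩ s ⟨ht0.trans hs.1.le, hs'.1.le⟩ hs.1 (by linarith)).trans ht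

lemma le_of_ae_locally_antitone {S : Set ℝ} (hT : 0 ≤ T) (hρ : 0 < ρ)
    (hF : ContinuousOn F (Icc 0 T)) (hS : ∀ᵐ t ∂vol T, t ∈ S)
    (hloc : ∀ t₁ ∈ Icc 0 T, ∀ t₂ ∈ Icc 0 T, t₁ < t₂ → t₂ - t₁ ≤ ρ → t₂ ∈ S → F t₂ ≤ F t₁) :
    F T ≤ F 0 := by
  refine le_of_locally_antitone hT hρ hF fun t₁ h₁ t₂ h₂ h₁₂ hlt => ?_
  set S' : Set ℝ := {t | t ∈ Ioo 0 T → t ∈ S}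
  have hdense : Dense S' := Measure.dense_of_ae (ae_imp_of_ae_restrict hS)
  have hclosure : t₂ ∈ closure (Ioo t₁ t₂ ∩ S') :=
    closure_minimal (hdense.open_subset_closure_inter isOpen_Ioo) isClosed_closure
      (by simpa [closure_Ioo h₁₂.ne] using h₁₂.le)
  have hsub {t : ℝ} (ht : t ∈ Ioo t₁ t₂) : t ∈ Ioo 0 T :=
    ⟨h₁.1.trans_lt ht.1, ht.2.trans_le h₂.2⟩
  refine ContinuousWithinAt.closure_le hclosure
    ((hF t₂ h₂).mono fun t ht => Ioo_subset_Icc_self (hsub ht.1)) continuousWithinAt_const ?_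
  exact fun t ht => hloc t₁ h₁ t (Ioo_subset_Icc_self (hsub ht.1)) ht.1.1
    (by linarith [ht.1.2]) (ht.2 (hsub ht.1))

end LocallyAntitone

section Penalty

variable {L T K M η κ : ℝ} {Θ Θ' Θ'' : ℝ → ℝ} {h J p : ℝ → ℝ → ℝ}

/-- A convex function `Θ` with first and second derivatives `Θ'` and `Θ''`, which is affine on
`(0, ∞)` and has curvature at most `K`. The functions `χ_δ` are the example of interest. -/
structure IsConvexPenalty (K : ℝ) (Θ Θ' Θ'' : ℝ → ℝ) : Prop where
  hasDerivAt : ∀ y, HasDerivAt Θ (Θ' y) y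
  hasDerivAt_deriv : ∀ y, HasDerivAt Θ' (Θ'' y) y
  nonneg : ∀ y, 0 ≤ Θ'' y
  le : ∀ y, Θ'' y ≤ K
  eq_zero_of_pos : ∀ y, 0 < y → Θ'' y = 0

/-- Where `h ≤ η`, the flux `J` is at most `κ` times the square root of the density `p`. -/
structure IsFluxBound (L T η κ : ℝ) (h J p : ℝ → ℝ → ℝ) : Prop where
  nonneg : ∀ t x, 0 ≤ p t x
  ae_integrable : ∀ᵐ t ∂vol T, Integrable (p t) (vol L)
  integrable_sqrt : Integrable (fun t => √(∫ x in Ioo 0 L, p t x)) (vol T)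
  sq_le : ∀ᵐ t ∂vol T, ∀ x ∈ Ioo 0 L, h t x ≤ η → J t x ^ 2 ≤ κ ^ 2 * p t x

namespace IsConvexPenalty

lemma abs_le (hΘ : IsConvexPenalty K Θ Θ' Θ'') (y : ℝ) : |Θ'' y| ≤ K :=
  (abs_of_nonneg (hΘ.nonneg y)).trans_le (hΘ.le y)

lemma bound_nonneg (hΘ : IsConvexPenalty K Θ Θ' Θ'') : 0 ≤ K := (hΘ.nonneg 0).trans (hΘ.le 0)

lemma continuous (hΘ : IsConvexPenalty K Θ Θ' Θ'') : Continuous Θ :=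
  continuous_iff_continuousAt.2 fun y => (hΘ.hasDerivAt y).continuousAt

lemma continuous_deriv (hΘ : IsConvexPenalty K Θ Θ' Θ'') : Continuous Θ' :=
  continuous_iff_continuousAt.2 fun y => (hΘ.hasDerivAt_deriv y).continuousAt

lemma sub_le (hΘ : IsConvexPenalty K Θ Θ' Θ'') (y z : ℝ) : Θ y - Θ z ≤ (y - z) * Θ' y := by
  have hderiv : deriv Θ = Θ' := funext fun y => (hΘ.hasDerivAt y).deriv
  have hconvex : ConvexOn ℝ univ Θ :=
    Monotone.convexOn_univ_of_deriv (fun y => (hΘ.hasDerivAt y).differentiableAt)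
      (hderiv ▸ monotone_of_hasDerivAt_nonneg hΘ.hasDerivAt_deriv hΘ.nonneg)
  rcases lt_trichotomy z y with hzy | rfl | hyz
  · have := hconvex.slope_le_of_hasDerivAt (mem_univ z) (mem_univ y) hzy (hΘ.hasDerivAt y)
    rwa [slope_def_field, div_le_iff₀' (sub_pos.2 hzy)] at this
  · simp
  · have := hconvex.le_slope_of_hasDerivAt (mem_univ y) (mem_univ z) hyz (hΘ.hasDerivAt y)
    rw [slope_def_field, le_div_iff₀ (sub_pos.2 hyz)] at this
    linarith

lemma exists_mem_H (hΘ : IsConvexPenalty K Θ Θ' Θ'') (hL : 0 < L) {w : ℝ → ℝ} (hw : MemH L 1 w)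
    (hwc : ContinuousOn w (Icc 0 L)) :
    ∃ z : H L 1, Represents z (fun x => Θ' (w x)) ∧
      z.1 1 =ᵐ[vol L] fun x => Θ'' (w x) * D L 1 w x := by
  have hmeas : Measurable Θ'' := by
    rw [← funext fun y => (hΘ.hasDerivAt_deriv y).deriv]
    exact measurable_deriv Θ'
  have hbound : MemLp (fun x => Θ'' (w x)) ∞ (vol L) :=
    MemLp.of_bound (hmeas.comp_aemeasurable
      (integrable_of_continuousOn hwc).aestronglyMeasurable.aemeasurable).aestronglyMeasurable K
      (.of_forall fun x => hΘ.abs_le (w x))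
  exact (hw.isWeakDeriv_D.comp hL hwc (hw.memLp_D.integrable one_le_two) hΘ.hasDerivAt_deriv
    hΘ.abs_le).exists_mem_H (memLp_of_continuousOn (hΘ.continuous_deriv.comp_continuousOn hwc) 2)
    (hw.memLp_D.mul hbound)

end IsConvexPenalty

lemma abs_integral_mul_mul_le {α : Type*} [MeasurableSpace α] {ν : Measure α}
    {j ψ v q : α → ℝ} (hκ : 0 ≤ κ) (hK : 0 ≤ K) (hq : Integrable q ν) (hq0 : 0 ≤ᵐ[ν] q)
    (hv : MemLp v 2 ν) (hψ : ∀ᵐ x ∂ν, |ψ x| ≤ K)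
    (hj : ∀ᵐ x ∂ν, ψ x ≠ 0 → j x ^ 2 ≤ κ ^ 2 * q x) :
    |∫ x, j x * (ψ x * v x) ∂ν| ≤ κ * K * (√(∫ x, q x ∂ν) * √(∫ x, v x ^ 2 ∂ν)) := by
  have hint : Integrable (fun x => √(q x) * |v x|) ν :=
    (memLp_two_sqrt hq hq0).integrable_mul hv.abs
  calc |∫ x, j x * (ψ x * v x) ∂ν| ≤ ∫ x, κ * K * (√(q x) * |v x|) ∂ν := by
        rw [← Real.norm_eq_abs]
        refine norm_integral_le_of_norm_le (hint.const_mul _) ?_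
        filter_upwards [hψ, hj] with x hψx hjx
        rw [Real.norm_eq_abs, abs_mul, abs_mul]
        rcases eq_or_ne (ψ x) 0 with hzero | hne
        · rw [hzero, abs_zero, zero_mul, mul_zero]
          positivity
        · have hjx' : |j x| ≤ κ * √(q x) := by
            simpa [Real.sqrt_mul, hκ] using Real.abs_le_sqrt (hjx hne)
          calc |j x| * (|ψ x| * |v x|) ≤ κ * √(q x) * (K * |v x|) := by gcongr
            _ = κ * K * (√(q x) * |v x|) := by ring
    _ ≤ κ * K * (√(∫ x, q x ∂ν) * √(∫ x, v x ^ 2 ∂ν)) := by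
        rw [integral_const_mul]
        gcongr
        exact integral_sqrt_mul_abs_le hq hq0 hv

/- The test function is frozen at the final time `t₂`: convexity bounds the increment of `Θ(h)` by
`Θ'(h t₂) (h t₂ - h t₁)`, so that no chain rule for the `(H¹)'`-valued derivative of `h` is
needed. -/
lemma WeakEquation.integral_comp_sub_le (hΘ : IsConvexPenalty K Θ Θ' Θ'')
    (hh : ContinuousOn (fun p : ℝ × ℝ => h p.1 p.2) (Icc 0 T ×ˢ Icc 0 L))
    (hw : WeakEquation L T h J) {t₁ t₂ : ℝ} (h₁ : t₁ ∈ Icc 0 T) (h₂ : t₂ ∈ Icc 0 T)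
    (h₁₂ : t₁ < t₂) {z : H L 1} (hz : Represents z fun x => Θ' (h t₂ x)) :
    (∫ x in Ioo 0 L, Θ (h t₂ x)) - ∫ x in Ioo 0 L, Θ (h t₁ x)
      ≤ ∫ t in Ioo t₁ t₂, ∫ x in Ioo 0 L, J t x * z.1 1 x := by
  have hc₁ := continuousOn_slice hh h₁
  have hc₂ := continuousOn_slice hh h₂
  have hi₁ := integrable_of_continuousOn (hΘ.continuous.comp_continuousOn hc₁)
  have hi₂ := integrable_of_continuousOn (hΘ.continuous.comp_continuousOn hc₂)
  calc (∫ x in Ioo 0 L, Θ (h t₂ x)) - ∫ x in Ioo 0 L, Θ (h t₁ x)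
      = ∫ x in Ioo 0 L, (Θ (h t₂ x) - Θ (h t₁ x)) := (integral_sub hi₂ hi₁).symm
    _ ≤ ∫ x in Ioo 0 L, (h t₂ x - h t₁ x) * Θ' (h t₂ x) :=
        integral_mono (hi₂.sub hi₁) (integrable_of_continuousOn
          ((hc₂.sub hc₁).mul (hΘ.continuous_deriv.comp_continuousOn hc₂)))
          fun x => hΘ.sub_le (h t₂ x) (h t₁ x)
    _ = ∫ x in Ioo 0 L, (h t₂ x - h t₁ x) * z.1 0 x :=
        integral_congr_ae (hz.mono fun x hx => by simp only [hx])
    _ = ∫ t in Ioo t₁ t₂, ∫ x in Ioo 0 L, J t x * z.1 1 x := hw.integral_sub_mul hh z h₁ h₂ h₁₂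

lemma IsFluxBound.integral_comp_sub_le (hJ : IsFluxBound L T η κ h J p) (hL : 0 < L)
    (hκ : 0 ≤ κ) (hM : 0 ≤ M) (hΘ : IsConvexPenalty K Θ Θ' Θ'')
    (hh : ContinuousOn (fun p : ℝ × ℝ => h p.1 p.2) (Icc 0 T ×ˢ Icc 0 L))
    (hw : WeakEquation L T h J) {t₁ t₂ : ℝ} (h₁ : t₁ ∈ Icc 0 T) (h₂ : t₂ ∈ Icc 0 T)
    (h₁₂ : t₁ < t₂) (hu : MemH L 1 (h t₂)) (huM : ∫ x in Ioo 0 L, D L 1 (h t₂) x ^ 2 ≤ M ^ 2)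
    (hη : ∀ t ∈ Ioo t₁ t₂, ∀ x ∈ Ioo 0 L, h t x ≤ h t₂ x + η) :
    (∫ x in Ioo 0 L, Θ (h t₂ x)) - ∫ x in Ioo 0 L, Θ (h t₁ x)
      ≤ κ * K * M * ∫ t in t₁..t₂, √(∫ x in Ioo 0 L, p t x) := by
  obtain ⟨z, hz, hz'⟩ := hΘ.exists_mem_H hL hu (continuousOn_slice hh h₂)
  have hsub : Ioo t₁ t₂ ⊆ Ioo 0 T := Ioo_subset_Ioo h₁.1 h₂.2
  have hK := hΘ.bound_nonneg
  refine (hw.integral_comp_sub_le hΘ hh h₁ h₂ h₁₂ hz).trans ?_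
  rw [intervalIntegral.integral_of_le h₁₂.le, integral_Ioc_eq_integral_Ioo, ← integral_const_mul]
  refine (Real.le_norm_self _).trans <| norm_integral_le_of_norm_le
    ((hJ.integrable_sqrt.mono_measure (Measure.restrict_mono hsub le_rfl)).const_mul _) ?_
  filter_upwards [ae_restrict_of_ae_restrict_of_subset hsub hJ.ae_integrable,
    ae_restrict_of_ae_restrict_of_subset hsub hJ.sq_le, ae_restrict_mem measurableSet_Ioo]
    with t hp hsq ht
  calc |∫ x in Ioo 0 L, J t x * z.1 1 x|
      = |∫ x in Ioo 0 L, J t x * (Θ'' (h t₂ x) * D L 1 (h t₂) x)| :=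
        congrArg _ (integral_congr_ae (hz'.mono fun x hx => by simp only [hx]))
    _ ≤ κ * K * (√(∫ x in Ioo 0 L, p t x) * √(∫ x in Ioo 0 L, D L 1 (h t₂) x ^ 2)) := by
        refine abs_integral_mul_mul_le hκ hK hp (.of_forall (hJ.nonneg t)) hu.memLp_D
          (.of_forall fun x => hΘ.abs_le _) ?_
        filter_upwards [ae_mem_Ioo] with x hx hne
        have hneg : h t₂ x ≤ 0 := not_lt.1 fun hpos => hne (hΘ.eq_zero_of_pos _ hpos)
        exact hsq x hx (by linarith [hη t ht x hx])
    _ ≤ κ * K * (√(∫ x in Ioo 0 L, p t x) * M) := by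
        gcongr
        exact (Real.sqrt_le_left hM).2 huM
    _ = κ * K * M * √(∫ x in Ioo 0 L, p t x) := by ring

lemma IsFluxBound.integral_comp_final_sub_le (hJ : IsFluxBound L T η κ h J p) (hL : 0 < L)
    (hT : 0 < T) (hη : 0 < η) (hκ : 0 ≤ κ) (hM : 0 ≤ M) (hΘ : IsConvexPenalty K Θ Θ' Θ'')
    (hh : ContinuousOn (fun p : ℝ × ℝ => h p.1 p.2) (Icc 0 T ×ˢ Icc 0 L))
    (hw : WeakEquation L T h J)
    (hu : ∀ᵐ t ∂vol T, MemH L 1 (h t) ∧ ∫ x in Ioo 0 L, D L 1 (h t) x ^ 2 ≤ M ^ 2) :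
    (∫ x in Ioo 0 L, Θ (h T x)) - ∫ x in Ioo 0 L, Θ (h 0 x)
      ≤ κ * K * M * ∫ t in Ioo 0 T, √(∫ x in Ioo 0 L, p t x) := by
  obtain ⟨ρ, hρ, hclose⟩ := Metric.uniformContinuousOn_iff.1
    ((isCompact_Icc.prod isCompact_Icc).uniformContinuousOn_of_continuous hh) η hη
  have hinterval {s t : ℝ} (hs : s ∈ Icc 0 T) (ht : t ∈ Icc 0 T) :
      IntervalIntegrable (fun t => √(∫ x in Ioo 0 L, p t x)) volume s t :=
    intervalIntegrable_of_integrable_vol hJ.integrable_sqrt hs ht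
  let F : ℝ → ℝ := fun t => (∫ x in Ioo 0 L, Θ (h t x))
    - κ * K * M * ∫ s in (0 : ℝ)..t, √(∫ x in Ioo 0 L, p s x)
  have hFc : ContinuousOn F (Icc 0 T) := by
    refine ContinuousOn.sub ?_ (.mul continuousOn_const ?_)
    · simpa using continuousOn_integral_mul (hΘ.continuous.comp_continuousOn hh)
        (integrable_const (μ := vol L) (1 : ℝ))
    · simpa [uIcc_of_le hT.le] using intervalIntegral.continuousOn_primitive_interval'
        (hinterval ⟨le_rfl, hT.le⟩ ⟨hT.le, le_rfl⟩) left_mem_uIcc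
  have hFT : F T ≤ F 0 := by
    refine le_of_ae_locally_antitone hT.le (half_pos hρ) hFc hu ?_
    rintro t₁ h₁ t₂ h₂ h₁₂ hlt ⟨hmem, hbound⟩
    have hshort := hJ.integral_comp_sub_le hL hκ hM hΘ hh hw h₁ h₂ h₁₂ hmem hbound
      fun s hs x hx => by
        have hsT : s ∈ Icc 0 T := ⟨h₁.1.trans hs.1.le, hs.2.le.trans h₂.2⟩
        have hdist := hclose (s, x) ⟨hsT, Ioo_subset_Icc_self hx⟩ (t₂, x)
          ⟨h₂, Ioo_subset_Icc_self hx⟩ (by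
            rw [Prod.dist_eq, dist_self, max_eq_left dist_nonneg, Real.dist_eq, abs_lt]
            constructor <;> linarith [hs.1, hs.2])
        linarith [(abs_lt.1 hdist).2]
    have hadd := intervalIntegral.integral_add_adjacent_intervals
      (hinterval ⟨le_rfl, hT.le⟩ h₁) (hinterval h₁ h₂)
    simp only [F, ← hadd, mul_add]
    linarith
  simp only [F, intervalIntegral.integral_same, mul_zero, sub_zero] at hFT
  rw [intervalIntegral.integral_of_le hT.le, integral_Ioc_eq_integral_Ioo] at hFT
  linarith

end Penalty

section Chi

variable {φ : ℝ → ℝ} {δ : ℝ}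

lemma hasDerivAt_integral_Ioi (hφ : Continuous φ) (hi : Integrable φ) (s : ℝ) :
    HasDerivAt (fun s => ∫ τ in Ioi s, φ τ) (-φ s) s := by
  have hsplit : (fun s => ∫ τ in Ioi s, φ τ)
      = fun s => (∫ τ in Ioi 0, φ τ) - ∫ τ in (0 : ℝ)..s, φ τ := by
    funext s
    rw [← intervalIntegral.integral_interval_add_Ioi (hi.integrableOn (s := Ioi 0))
      (hi.integrableOn (s := Ioi s)), add_sub_cancel_left]
  rw [hsplit]
  exact (intervalIntegral.integral_hasDerivAt_right (hφ.intervalIntegrable _ _)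
    (hφ.stronglyMeasurableAtFilter _ _) hφ.continuousAt).const_sub _

lemma hasDerivAt_chi (hφ : Continuous φ) (hi : Integrable φ) (hδ : δ ≠ 0) (y : ℝ) :
    HasDerivAt (chi φ δ) (-∫ τ in Ioi (y / δ), φ τ) y := by
  have hc : Continuous fun s => ∫ τ in Ioi s, φ τ :=
    continuous_iff_continuousAt.2 fun s => (hasDerivAt_integral_Ioi hφ hi s).continuousAt
  have hprim := intervalIntegral.integral_hasDerivAt_right (hc.intervalIntegrable 0 (y / δ))
    (hc.stronglyMeasurableAtFilter _ _) hc.continuousAt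
  refine ((hprim.comp y ((hasDerivAt_id y).div_const δ)).neg.const_mul δ).congr_deriv ?_
  field_simp

lemma exists_isConvexPenalty_chi (hφ : Continuous φ) (hφ0 : ∀ x, 0 ≤ φ x)
    (hφs : tsupport φ ⊆ Icc (-1) 0) :
    ∃ K, 0 ≤ K ∧ ∀ δ > 0, IsConvexPenalty (K / δ) (chi φ δ)
      (fun y => -∫ τ in Ioi (y / δ), φ τ) fun y => φ (y / δ) / δ := by
  have hcomp : HasCompactSupport φ := isCompact_Icc.of_isClosed_subset (isClosed_tsupport φ) hφs
  have hi : Integrable φ := hφ.integrable_of_hasCompactSupport hcomp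
  obtain ⟨K, hK⟩ := hcomp.exists_bound_of_continuous hφ
  refine ⟨K, (norm_nonneg _).trans (hK 0), fun δ hδ => ⟨hasDerivAt_chi hφ hi hδ.ne', fun y => ?_,
    fun y => div_nonneg (hφ0 _) hδ.le, fun y => ?_, fun y hy => ?_⟩⟩
  · refine ((hasDerivAt_integral_Ioi hφ hi (y / δ)).comp y
      ((hasDerivAt_id y).div_const δ)).neg.congr_deriv ?_
    ring
  · gcongr
    exact (Real.le_norm_self _).trans (hK _)
  · have hout : y / δ ∉ tsupport φ := fun hmem => (div_pos hy hδ).not_ge (hφs hmem).2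
    rw [image_eq_zero_of_notMem_tsupport hout, zero_div]

lemma chi_eq_zero (hφs : tsupport φ ⊆ Icc (-1) 0) (hδ : 0 ≤ δ) {y : ℝ} (hy : 0 ≤ y) :
    chi φ δ y = 0 := by
  have htail {s : ℝ} (hs : 0 ≤ s) : ∫ τ in Ioi s, φ τ = 0 :=
    setIntegral_eq_zero_of_forall_eq_zero fun τ hτ =>
      image_eq_zero_of_notMem_tsupport fun hmem => (hs.trans_lt hτ).not_ge (hφs hmem).2
  have hzero : ∫ s in (0 : ℝ)..(y / δ), ∫ τ in Ioi s, φ τ = 0 :=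
    intervalIntegral.integral_zero_ae <| .of_forall fun s hs => by
      rw [uIoc_of_le (div_nonneg hy hδ)] at hs
      exact htail hs.1.le
  rw [chi, hzero, neg_zero, mul_zero]

lemma chi_nonneg (hφ0 : ∀ x, 0 ≤ φ x) (hφs : tsupport φ ⊆ Icc (-1) 0) (hδ : 0 ≤ δ) (y : ℝ) :
    0 ≤ chi φ δ y := by
  rcases le_total 0 y with hy | hy
  · exact (chi_eq_zero hφs hδ hy).ge
  · rw [chi, ← intervalIntegral.integral_symm]
    exact mul_nonneg hδ <| intervalIntegral.integral_nonneg (div_nonpos_of_nonpos_of_nonneg hy hδ)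
      fun s _ => integral_nonneg hφ0

lemma neg_sub_le_chi (hφ : Continuous φ) (hφ0 : ∀ x, 0 ≤ φ x) (hφs : tsupport φ ⊆ Icc (-1) 0)
    (hφ1 : ∫ x, φ x = 1) (hδ : 0 < δ) (y : ℝ) : -y - δ ≤ chi φ δ y := by
  obtain ⟨K, -, hchi⟩ := exists_isConvexPenalty_chi hφ hφ0 hφs
  have htail : ∫ τ in Ioi (-1), φ τ = 1 := by
    rw [← integral_Ici_eq_integral_Ioi]
    exact (setIntegral_eq_integral_of_forall_compl_eq_zero fun τ hτ =>
      image_eq_zero_of_notMem_tsupport fun hmem => hτ (hφs hmem).1).trans hφ1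
  have htangent := (hchi δ hδ).sub_le (-δ) y
  rw [neg_div, div_self hδ.ne', htail] at htangent
  linarith [chi_nonneg hφ0 hφs hδ.le (-δ)]

lemma integral_chi_eq_zero (hφs : tsupport φ ⊆ Icc (-1) 0) (hδ : 0 ≤ δ) {α : Type*}
    [MeasurableSpace α] {ν : Measure α} {w : α → ℝ} (hw : 0 ≤ᵐ[ν] w) :
    ∫ x, chi φ δ (w x) ∂ν = 0 :=
  integral_eq_zero_of_ae (hw.mono fun _ => chi_eq_zero hφs hδ)

lemma nonneg_of_integral_negPart_nonpos {L : ℝ} {w : ℝ → ℝ} (hL : L ≠ 0)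
    (hw : ContinuousOn w (Icc 0 L)) (hle : ∫ x in Ioo 0 L, (w x)⁻ ≤ 0) :
    ∀ x ∈ Icc 0 L, 0 ≤ w x := by
  have hneg := continuous_negPart.comp_continuousOn hw
  have hae : (fun x => (w x)⁻) =ᵐ[vol L] 0 :=
    (integral_eq_zero_iff_of_nonneg (fun x => negPart_nonneg (w x))
      (integrable_of_continuousOn hneg)).1
      (hle.antisymm (integral_nonneg fun x => negPart_nonneg (w x)))
  rw [vol, Measure.restrict_congr_set Ioo_ae_eq_Icc] at hae
  exact fun x hx => negPart_eq_zero.1 <|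
    Measure.eqOn_Icc_of_ae_eq volume hL.symm hae hneg continuousOn_const hx

lemma nonneg_of_tendsto_integral_chi {L : ℝ} (hL : 0 < L) (hφ : Continuous φ)
    (hφ0 : ∀ x, 0 ≤ φ x) (hφs : tsupport φ ⊆ Icc (-1) 0) (hφ1 : ∫ x, φ x = 1)
    {ι : Type*} {l : Filter ι} [l.NeBot] [l.IsCountablyGenerated] {δ : ι → ℝ}
    (hδ : ∀ k, 0 < δ k) (hδ0 : Tendsto δ l (𝓝 0)) {W : ι → ℝ → ℝ} {w : ℝ → ℝ}
    (hW : ∀ k, ContinuousOn (W k) (Icc 0 L))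
    (hlim : TendstoUniformlyOn W w l (Icc 0 L))
    (hχ : Tendsto (fun k => ∫ x in Ioo 0 L, chi φ (δ k) (W k x)) l (𝓝 0)) :
    ∀ x ∈ Icc 0 L, 0 ≤ w x := by
  obtain ⟨K, -, hchi⟩ := exists_isConvexPenalty_chi hφ hφ0 hφs
  have hneg (k : ι) : ContinuousOn (fun x => (W k x)⁻) (Icc 0 L) :=
    continuous_negPart.comp_continuousOn (hW k)
  have hlimneg : Tendsto (fun k => ∫ x in Ioo 0 L, (W k x)⁻) l (𝓝 (∫ x in Ioo 0 L, (w x)⁻)) := by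
    simp only [← integral_Ioc_eq_integral_Ioo, ← intervalIntegral.integral_of_le hL.le]
    refine TendstoUniformlyOn.tendsto_intervalIntegral_of_continuousOn ?_ ?_ <;>
      rw [uIcc_of_le hL.le]
    exacts [.of_forall hneg, lipschitzWith_negPart.uniformContinuous.comp_tendstoUniformlyOn hlim]
  refine nonneg_of_integral_negPart_nonpos hL.ne' (hlim.continuousOn (.of_forall hW)) ?_
  refine le_of_tendsto_of_tendsto' hlimneg (by simpa using hχ.add (hδ0.mul_const L)) fun k => ?_
  have hχi : Integrable (fun x => chi φ (δ k) (W k x)) (vol L) :=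
    integrable_of_continuousOn ((hchi (δ k) (hδ k)).continuous.comp_continuousOn (hW k))
  calc ∫ x in Ioo 0 L, (W k x)⁻ ≤ ∫ x in Ioo 0 L, (chi φ (δ k) (W k x) + δ k) :=
        integral_mono (integrable_of_continuousOn (hneg k)) (hχi.add (integrable_const _))
          fun x => max_le (by linarith [neg_sub_le_chi hφ hφ0 hφs hφ1 (hδ k) (W k x)])
            (add_nonneg (chi_nonneg hφ0 hφs (hδ k).le _) (hδ k).le)
    _ = (∫ x in Ioo 0 L, chi φ (δ k) (W k x)) + δ k * L := by
        rw [integral_add hχi (integrable_const _)]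
        simp [Real.volume_real_Ioo_of_le hL.le, mul_comm]

end Chi

section Energy

variable {L R : ℝ} {u v : ℝ → ℝ}

lemma energy_nonneg (hR : 0 ≤ R) : 0 ≤ energy L R u v :=
  mul_nonneg (by norm_num) (integral_nonneg fun x => by positivity)

lemma energy_eq (hu : MemH L 1 u) (hv : MemH L 1 v) :
    2 * energy L R u v = (∫ x in Ioo 0 L, D L 1 u x ^ 2)
      + R * ∫ x in Ioo 0 L, (D L 1 u x + D L 1 v x) ^ 2 := by
  have hsum : Integrable (fun x => (D L 1 u x + D L 1 v x) ^ 2) (vol L) :=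
    (hu.memLp_D.add hv.memLp_D).integrable_sq
  rw [energy, integral_add hu.memLp_D.integrable_sq (hsum.const_mul R), integral_const_mul]
  ring

lemma integral_sq_D_fst_le (hR : 0 ≤ R) (hu : MemH L 1 u) (hv : MemH L 1 v) :
    ∫ x in Ioo 0 L, D L 1 u x ^ 2 ≤ 2 * energy L R u v := by
  rw [energy_eq hu hv]
  exact le_add_of_nonneg_right (mul_nonneg hR (integral_nonneg fun x => sq_nonneg _))

lemma integral_sq_D_snd_le (hR : 0 < R) (hu : MemH L 1 u) (hv : MemH L 1 v) :
    ∫ x in Ioo 0 L, D L 1 v x ^ 2 ≤ (4 + 4 / R) * energy L R u v := by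
  have hu2 := hu.memLp_D.integrable_sq
  have hsum : Integrable (fun x => (D L 1 u x + D L 1 v x) ^ 2) (vol L) :=
    (hu.memLp_D.add hv.memLp_D).integrable_sq
  have hsum_le : ∫ x in Ioo 0 L, (D L 1 u x + D L 1 v x) ^ 2 ≤ 2 * energy L R u v / R := by
    rw [le_div_iff₀' hR, energy_eq hu hv]
    exact le_add_of_nonneg_left (integral_nonneg fun x => sq_nonneg _)
  calc ∫ x in Ioo 0 L, D L 1 v x ^ 2
      ≤ ∫ x in Ioo 0 L, (2 * (D L 1 u x + D L 1 v x) ^ 2 + 2 * D L 1 u x ^ 2) :=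
        integral_mono hv.memLp_D.integrable_sq ((hsum.const_mul 2).add (hu2.const_mul 2))
          fun x => by nlinarith [sq_nonneg (2 * D L 1 u x + D L 1 v x)]
    _ = 2 * (∫ x in Ioo 0 L, (D L 1 u x + D L 1 v x) ^ 2) + 2 * ∫ x in Ioo 0 L, D L 1 u x ^ 2 := by
        rw [integral_add (hsum.const_mul 2) (hu2.const_mul 2), integral_const_mul,
          integral_const_mul]
    _ ≤ 2 * (2 * energy L R u v / R) + 2 * (2 * energy L R u v) := by
        gcongr
        exact integral_sq_D_fst_le hR.le hu hv
    _ = (4 + 4 / R) * energy L R u v := by ring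

end Energy

/-- The bound on `‖∂_x f(t)‖_{L₂}` and `‖∂_x g(t)‖_{L₂}` provided by the energy inequality. -/
noncomputable def slopeBound (L R : ℝ) (f₀ g₀ : ℝ → ℝ) : ℝ :=
  √((4 + 4 / R) * energy L R f₀ g₀)

/-- A bound on `a_ε(f)` for `ε ≤ 1`, from the mass `‖f₀‖_{L₁}` and the bound on `∂_x f`. -/
noncomputable def mobilityBound (L R : ℝ) (f₀ g₀ : ℝ → ℝ) : ℝ :=
  1 + ((∫ x in Ioo 0 L, |f₀ x|) / L + √L * slopeBound L R f₀ g₀)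

lemma mobilityBound_nonneg {L R : ℝ} {f₀ g₀ : ℝ → ℝ} (hL : 0 ≤ L) :
    0 ≤ mobilityBound L R f₀ g₀ := by
  unfold mobilityBound slopeBound
  positivity

lemma MemLpH.ae_memH {L T : ℝ} {q : ℝ≥0∞} {k : ℕ} {w : ℝ → ℝ → ℝ} (hw : MemLpH L T q k w) :
    ∀ᵐ t ∂vol T, MemH L k (w t) :=
  let ⟨U, _, hU⟩ := hw
  hU.mono fun t ht => ⟨U t, ht⟩

namespace IsRegularizedSolution

variable {L R μ ε T K κ : ℝ} {f₀ g₀ : ℝ → ℝ} {f g h J : ℝ → ℝ → ℝ} {Θ Θ' Θ'' : ℝ → ℝ}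

lemma ae_integral_sq_D_le (hs : IsRegularizedSolution L R μ ε f₀ g₀ f g) (hR : 0 < R)
    (hμ : 0 ≤ μ) (hε : 0 ≤ ε) (hT : 0 < T) :
    ∀ᵐ t ∂vol T,
      (MemH L 1 (f t) ∧ ∫ x in Ioo 0 L, D L 1 (f t) x ^ 2 ≤ slopeBound L R f₀ g₀ ^ 2) ∧
      (MemH L 1 (g t) ∧ ∫ x in Ioo 0 L, D L 1 (g t) x ^ 2 ≤ slopeBound L R f₀ g₀ ^ 2) := by
  filter_upwards [(hs.regular_f.memLinfty T hT).ae_memH, (hs.regular_g.memLinfty T hT).ae_memH,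
    ae_restrict_of_ae_restrict_of_subset Ioo_subset_Ioi_self hs.energy_le] with t hf hg hle
  have hdiss : 0 ≤ ∫ s in Ioo 0 t, dissipation L R μ ε f g s :=
    integral_nonneg fun s => dissipation_nonneg hμ hε
  have henergy : energy L R (f t) (g t) ≤ energy L R f₀ g₀ := by linarith
  have hpos := energy_nonneg (L := L) (u := f t) (v := g t) hR.le
  rw [slopeBound, Real.sq_sqrt (mul_nonneg (by positivity) (hpos.trans henergy))]
  refine ⟨⟨hf, (integral_sq_D_fst_le hR.le hf hg).trans ?_⟩,
    ⟨hg, (integral_sq_D_snd_le hR hf hg).trans (by gcongr)⟩⟩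
  gcongr
  linarith [div_pos four_pos hR]

lemma ae_a_le_mobilityBound (hs : IsRegularizedSolution L R μ ε f₀ g₀ f g) (hL : 0 < L)
    (hR : 0 < R) (hμ : 0 ≤ μ) (hε : 0 ≤ ε) (hε1 : ε ≤ 1) (hT : 0 < T) :
    ∀ᵐ t ∂vol T, ∀ x ∈ Ioo 0 L, a ε (f t x) ≤ mobilityBound L R f₀ g₀ := by
  filter_upwards [hs.ae_integral_sq_D_le hR hμ hε hT, ae_mem_Ioo] with t ⟨⟨hmem, hslope⟩, _⟩ ht x hx
  have hM : 0 ≤ slopeBound L R f₀ g₀ := Real.sqrt_nonneg _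
  have hle := hmem.le_of_integral_sq_D_le hL
    (continuousOn_slice (hs.regular_f.continuousOn hT) (Ioo_subset_Icc_self ht)) hM hslope
    (hs.mass_f t ht.1.le) (Ioo_subset_Icc_self hx)
  exact add_le_add hε1 (max_le (by positivity) hle)

lemma integral_dissipation_le (hs : IsRegularizedSolution L R μ ε f₀ g₀ f g) (hR : 0 ≤ R)
    (hμ : 0 ≤ μ) (hε : 0 ≤ ε) (hT : 0 < T) :
    ∫ t in Ioo 0 T, dissipation L R μ ε f g t ≤ energy L R f₀ g₀ := by
  -- The energy inequality may fail at `T` itself, so it is used at a slightly larger time.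
  obtain ⟨T', hTT', hle⟩ : ∃ T' > T, energy L R (f T') (g T')
      + ∫ t in Ioo 0 T', dissipation L R μ ε f g t ≤ energy L R f₀ g₀ := by
    have hae := ae_restrict_of_ae_restrict_of_subset (Ioi_subset_Ioi hT.le) hs.energy_le
    have : (ae (volume.restrict (Ioi T))).NeBot :=
      ae_neBot.2 (by rw [Ne, Measure.restrict_eq_zero, Real.volume_Ioi]; exact ENNReal.top_ne_zero)
    exact ((ae_restrict_mem measurableSet_Ioi).and hae).exists
  have hmono : ∫ t in Ioo 0 T, dissipation L R μ ε f g t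
      ≤ ∫ t in Ioo 0 T', dissipation L R μ ε f g t :=
    setIntegral_mono_set (hs.regular_f.integrable_dissipation hs.regular_g (hT.trans hTT') hε)
      (.of_forall fun t => dissipation_nonneg hμ hε) (Ioo_subset_Ioo_right hTT'.le).eventuallyLE
  linarith [energy_nonneg (L := L) (u := f T') (v := g T') hR]

lemma integral_sqrt_dissipation_le (hs : IsRegularizedSolution L R μ ε f₀ g₀ f g) (hR : 0 ≤ R)
    (hμ : 0 ≤ μ) (hε : 0 ≤ ε) (hT : 0 < T) :
    ∫ t in Ioo 0 T, √(dissipation L R μ ε f g t) ≤ √(energy L R f₀ g₀) * √T := by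
  calc ∫ t in Ioo 0 T, √(dissipation L R μ ε f g t)
      ≤ √(∫ t in Ioo 0 T, dissipation L R μ ε f g t) * √T := by
        simpa [Real.volume_real_Ioo_of_le hT.le] using integral_sqrt_mul_abs_le
          (hs.regular_f.integrable_dissipation hs.regular_g hT hε)
          (.of_forall fun t => dissipation_nonneg hμ hε) (memLp_const (1 : ℝ))
    _ ≤ √(energy L R f₀ g₀) * √T := by
        gcongr
        exact hs.integral_dissipation_le hR hμ hε hT

lemma integral_comp_final_sub_le (hs : IsRegularizedSolution L R μ ε f₀ g₀ f g) (hL : 0 < L)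
    (hR : 0 ≤ R) (hμ : 0 ≤ μ) (hε : 0 < ε) (hT : 0 < T) (hΘ : IsConvexPenalty K Θ Θ' Θ'')
    (hh : ContinuousOn (fun p : ℝ × ℝ => h p.1 p.2) (Icc 0 T ×ˢ Icc 0 L))
    (hw : WeakEquation L T h J) {M : ℝ} (hM : 0 ≤ M)
    (hu : ∀ᵐ t ∂vol T, MemH L 1 (h t) ∧ ∫ x in Ioo 0 L, D L 1 (h t) x ^ 2 ≤ M ^ 2)
    (hκ : 0 ≤ κ)
    (hJ : ∀ᵐ t ∂vol T, ∀ x ∈ Ioo 0 L, h t x ≤ ε → J t x ^ 2 ≤ κ ^ 2 * density L R μ ε f g t x) :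
    (∫ x in Ioo 0 L, Θ (h T x)) - ∫ x in Ioo 0 L, Θ (h 0 x)
      ≤ κ * K * M * (√(energy L R f₀ g₀) * √T) := by
  have hdensity := hs.regular_f.ae_integral_density (R := R) (μ := μ) (ε := ε) hs.regular_g hT
  have hsqrt : (fun t => √(dissipation L R μ ε f g t))
      =ᵐ[vol T] fun t => √(∫ x in Ioo 0 L, density L R μ ε f g t x) :=
    hdensity.mono fun t ht => congrArg _ ht.2.symm
  have hdiss := hs.regular_f.integrable_dissipation (R := R) (μ := μ) hs.regular_g hT hε.le
  have hbound : IsFluxBound L T ε κ h J (density L R μ ε f g) :=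
    { nonneg := fun t x => density_nonneg hμ hε.le
      ae_integrable := hdensity.mono fun t ht => ht.1
      integrable_sqrt := ((memLp_two_sqrt hdiss (.of_forall fun t =>
        dissipation_nonneg hμ hε.le)).integrable one_le_two).congr hsqrt
      sq_le := hJ }
  refine (hbound.integral_comp_final_sub_le hL hT hε hκ hM hΘ hh hw hu).trans ?_
  rw [← integral_congr_ae hsqrt]
  have hK := hΘ.bound_nonneg
  gcongr
  exact hs.integral_sqrt_dissipation_le hR hμ hε.le hT

end IsRegularizedSolution

section NegativePart

variable {L R μ ε T K : ℝ} {φ f₀ g₀ : ℝ → ℝ} {f g : ℝ → ℝ → ℝ}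

lemma IsRegularizedSolution.integral_chi_fst_le (hs : IsRegularizedSolution L R μ ε f₀ g₀ f g)
    (hL : 0 < L) (hR : 0 < R) (hμ : 0 ≤ μ) (hε : 0 < ε) (hT : 0 < T)
    (hφs : tsupport φ ⊆ Icc (-1) 0) (hf₀ : 0 ≤ᵐ[vol L] f₀) {Θ' Θ'' : ℝ → ℝ}
    (hχ : IsConvexPenalty (K / √ε) (chi φ √ε) Θ' Θ'') :
    ∫ x in Ioo 0 L, chi φ √ε (f T x)
      ≤ 3 * K * slopeBound L R f₀ g₀ * √(energy L R f₀ g₀) * √T * ε := by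
  have hinit : ∫ x in Ioo 0 L, chi φ √ε (f 0 x) = 0 :=
    integral_chi_eq_zero hφs (Real.sqrt_nonneg ε) (hf₀.trans_eq hs.initial_f.symm)
  have hflux : ∀ᵐ t ∂vol T, ∀ x ∈ Ioo 0 L, f t x ≤ ε →
      fluxF L R ε f g t x ^ 2 ≤ (3 * (ε * √ε)) ^ 2 * density L R μ ε f g t x := by
    refine .of_forall fun t x _ hx => (fluxF_sq_le hμ hε.le).trans ?_
    have ha := a_le_two_mul hx hε.le
    have ha0 := a_nonneg hε.le (f t x)
    have hp := density_nonneg (L := L) (R := R) (f := f) (g := g) (t := t) (x := x) hμ hε.le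
    gcongr
    calc a ε (f t x) ^ 3 ≤ (2 * ε) ^ 3 := by gcongr
      _ ≤ 9 * ε ^ 3 := by nlinarith [pow_pos hε 3]
      _ = (3 * (ε * √ε)) ^ 2 := by rw [mul_pow, mul_pow, Real.sq_sqrt hε.le]; ring
  have hfinal := hs.integral_comp_final_sub_le hL hR.le hμ hε hT hχ
    (hs.regular_f.continuousOn hT) (hs.equation_f T hT) (Real.sqrt_nonneg _)
    ((hs.ae_integral_sq_D_le hR hμ hε.le hT).mono fun t ht => ht.1) (by positivity) hflux
  rw [hinit, sub_zero] at hfinal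
  refine hfinal.trans_eq ?_
  rw [slopeBound]
  field_simp

lemma IsRegularizedSolution.integral_chi_snd_le (hs : IsRegularizedSolution L R μ ε f₀ g₀ f g)
    (hL : 0 < L) (hR : 0 < R) (hμ : 0 ≤ μ) (hε : 0 < ε) (hε1 : ε ≤ 1) (hT : 0 < T)
    (hφs : tsupport φ ⊆ Icc (-1) 0) (hg₀ : 0 ≤ᵐ[vol L] g₀) {Θ' Θ'' : ℝ → ℝ}
    (hχ : IsConvexPenalty (K / √ε) (chi φ √ε) Θ' Θ'') :
    ∫ x in Ioo 0 L, chi φ √ε (g T x) ≤ 2 * √(3 * mobilityBound L R f₀ g₀ + 2 * μ)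
      * K * slopeBound L R f₀ g₀ * √(energy L R f₀ g₀) * √(T * ε) := by
  have hinit : ∫ x in Ioo 0 L, chi φ √ε (g 0 x) = 0 :=
    integral_chi_eq_zero hφs (Real.sqrt_nonneg ε) (hg₀.trans_eq hs.initial_g.symm)
  have hA : 0 ≤ mobilityBound L R f₀ g₀ := mobilityBound_nonneg hL.le
  have hflux : ∀ᵐ t ∂vol T, ∀ x ∈ Ioo 0 L, g t x ≤ ε → fluxG L R μ ε f g t x ^ 2
      ≤ (2 * ε * √(3 * mobilityBound L R f₀ g₀ + 2 * μ)) ^ 2 * density L R μ ε f g t x := by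
    filter_upwards [hs.ae_a_le_mobilityBound hL hR hμ hε.le hε1 hT] with t hf x hx hgx
    have ha := a_le_two_mul hgx hε.le
    have ha0 := a_nonneg hε.le (g t x)
    have haf := a_nonneg hε.le (f t x)
    have hp := density_nonneg (L := L) (R := R) (f := f) (g := g) (t := t) (x := x) hμ hε.le
    have hmob : 3 * a ε (f t x) + μ * a ε (g t x) ≤ 3 * mobilityBound L R f₀ g₀ + 2 * μ := by
      nlinarith [hf x hx, mul_le_mul_of_nonneg_left (ha.trans (by linarith : 2 * ε ≤ 2)) hμ]
    rw [mul_pow _ √_, Real.sq_sqrt (by positivity)]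
    refine (fluxG_sq_le hμ hε.le).trans ?_
    gcongr
  have hfinal := hs.integral_comp_final_sub_le hL hR.le hμ hε hT hχ
    (hs.regular_g.continuousOn hT) (hs.equation_g T hT) (Real.sqrt_nonneg _)
    ((hs.ae_integral_sq_D_le hR hμ hε.le hT).mono fun t ht => ht.2) (by positivity) hflux
  rw [hinit, sub_zero] at hfinal
  calc ∫ x in Ioo 0 L, chi φ √ε (g T x)
      ≤ 2 * √(3 * mobilityBound L R f₀ g₀ + 2 * μ) * K * slopeBound L R f₀ g₀
          * √(energy L R f₀ g₀) * (√T * (ε / √ε)) := hfinal.trans_eq (by rw [slopeBound]; ring)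
    _ = 2 * √(3 * mobilityBound L R f₀ g₀ + 2 * μ) * K * slopeBound L R f₀ g₀
          * √(energy L R f₀ g₀) * √(T * ε) := by rw [Real.div_sqrt, Real.sqrt_mul hT.le]

end NegativePart

section Main

variable {L R μ : ℝ} {φ f₀ g₀ : ℝ → ℝ}

lemma exists_abs_integral_chi_le (hL : 0 < L) (hR : 0 < R) (hμ : 0 ≤ μ) (hφ : Continuous φ)
    (hφ0 : ∀ x, 0 ≤ φ x) (hφs : tsupport φ ⊆ Icc (-1) 0) (hf₀ : 0 ≤ᵐ[vol L] f₀)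
    (hg₀ : 0 ≤ᵐ[vol L] g₀) :
    ∃ C : ℝ, ∀ ε : ℝ, 0 < ε → ε ≤ 1 → ∀ f g : ℝ → ℝ → ℝ,
      IsRegularizedSolution L R μ ε f₀ g₀ f g → ∀ T : ℝ, 0 ≤ T →
        |∫ x in Ioo 0 L, chi φ √ε (f T x)| ≤ C * √T * ε ∧
        |∫ x in Ioo 0 L, chi φ √ε (g T x)| ≤ C * √(T * ε) := by
  obtain ⟨K, hK, hχ⟩ := exists_isConvexPenalty_chi hφ hφ0 hφs
  set M := slopeBound L R f₀ g₀
  have hM0 : 0 ≤ M := Real.sqrt_nonneg _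
  set B := √(3 * mobilityBound L R f₀ g₀ + 2 * μ)
  refine ⟨(3 + 2 * B) * K * M * √(energy L R f₀ g₀), fun ε hε hε1 f g hs T hT => ?_⟩
  have hδ : 0 < √ε := Real.sqrt_pos.2 hε
  rcases hT.eq_or_lt with rfl | hT
  · rw [integral_chi_eq_zero hφs hδ.le (hf₀.trans_eq hs.initial_f.symm),
      integral_chi_eq_zero hφs hδ.le (hg₀.trans_eq hs.initial_g.symm)]
    simp
  have habs (w : ℝ → ℝ) : |∫ x in Ioo 0 L, chi φ √ε (w x)| = ∫ x in Ioo 0 L, chi φ √ε (w x) :=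
    abs_of_nonneg (integral_nonneg fun x => chi_nonneg hφ0 hφs hδ.le _)
  rw [habs, habs]
  constructor
  · refine (hs.integral_chi_fst_le hL hR hμ hε hT hφs hf₀ (hχ _ hδ)).trans ?_
    gcongr
    exact le_add_of_nonneg_right (by positivity)
  · refine (hs.integral_chi_snd_le hL hR hμ hε hε1 hT hφs hg₀ (hχ _ hδ)).trans ?_
    gcongr
    exact le_add_of_nonneg_left (by norm_num)

lemma nonneg_of_tendstoUniformlyOn (hL : 0 < L) (hR : 0 < R) (hμ : 0 ≤ μ) (hφ : Continuous φ)
    (hφ0 : ∀ x, 0 ≤ φ x) (hφs : tsupport φ ⊆ Icc (-1) 0) (hφ1 : ∫ x, φ x = 1)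
    (hf₀ : 0 ≤ᵐ[vol L] f₀) (hg₀ : 0 ≤ᵐ[vol L] g₀) {T : ℝ} (hT : 0 < T) {ε : ℕ → ℝ}
    (hε : ∀ k, 0 < ε k ∧ ε k ≤ 1) (hε0 : Tendsto ε atTop (𝓝 0)) {F G : ℕ → ℝ → ℝ → ℝ}
    (hs : ∀ k, IsRegularizedSolution L R μ (ε k) f₀ g₀ (F k) (G k)) {f g : ℝ × ℝ → ℝ}
    (hF : TendstoUniformlyOn (fun k p => F k p.1 p.2) f atTop (Icc 0 T ×ˢ Icc 0 L))
    (hG : TendstoUniformlyOn (fun k p => G k p.1 p.2) g atTop (Icc 0 T ×ˢ Icc 0 L)) :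
    ∀ p ∈ Icc 0 T ×ˢ Icc 0 L, 0 ≤ f p ∧ 0 ≤ g p := by
  obtain ⟨C, hC⟩ := exists_abs_integral_chi_le hL hR hμ hφ hφ0 hφs hf₀ hg₀
  rintro ⟨t, x⟩ ⟨ht, hx⟩
  have hδ (k : ℕ) : 0 < √(ε k) := Real.sqrt_pos.2 (hε k).1
  have hδ0 : Tendsto (fun k => √(ε k)) atTop (𝓝 0) := by simpa using hε0.sqrt
  have hmaps : MapsTo (Prod.mk t) (Icc 0 L) (Icc 0 T ×ˢ Icc 0 L) := fun y hy => ⟨ht, hy⟩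
  have hnonneg {w : ℝ × ℝ → ℝ} {W : ℕ → ℝ → ℝ → ℝ} (hW : ∀ k, IsRegular L (W k))
      (hlim : TendstoUniformlyOn (fun k p => W k p.1 p.2) w atTop (Icc 0 T ×ˢ Icc 0 L))
      (hχ : Tendsto (fun k => ∫ x in Ioo 0 L, chi φ √(ε k) (W k t x)) atTop (𝓝 0)) :
      0 ≤ w (t, x) :=
    nonneg_of_tendsto_integral_chi (w := fun y => w (t, y)) hL hφ hφ0 hφs hφ1 hδ hδ0
      (fun k => continuousOn_slice ((hW k).continuousOn hT) ht)
      ((hlim.comp (Prod.mk t)).mono hmaps) hχ x hx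
  have hbound (k : ℕ) := hC (ε k) (hε k).1 (hε k).2 _ _ (hs k) t ht.1
  refine ⟨hnonneg (fun k => (hs k).regular_f) hF (squeeze_zero_norm (fun k => (hbound k).1) ?_),
    hnonneg (fun k => (hs k).regular_g) hG (squeeze_zero_norm (fun k => (hbound k).2) ?_)⟩
  · simpa using hε0.const_mul (C * √t)
  · simpa using (hε0.const_mul t).sqrt.const_mul C

end Main

end ThinFilm

theorem lemma2p2_general (L R μ : ℝ) (hL : 0 < L) (hR : 0 < R) (hμ : 0 ≤ μ)
    (φ : ℝ → ℝ) (hφ : Continuous φ) (hφ0 : ∀ x, 0 ≤ φ x)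
    (hφs : tsupport φ ⊆ Icc (-1) 0) (hφ1 : ∫ x, φ x = 1)
    (f₀ g₀ : ℝ → ℝ) (hf₀ : ∀ᵐ x ∂ThinFilm.vol L, 0 ≤ f₀ x)
    (hg₀ : ∀ᵐ x ∂ThinFilm.vol L, 0 ≤ g₀ x) :
    (∃ C : ℝ, ∀ ε : ℝ, 0 < ε → ε ≤ 1 → ∀ f g : ℝ → ℝ → ℝ,
      ThinFilm.IsRegularizedSolution L R μ ε f₀ g₀ f g → ∀ T : ℝ, 0 ≤ T →
        |∫ x in Ioo 0 L, ThinFilm.chi φ (√ε) (f T x)| ≤ C * √T * ε ∧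
        |∫ x in Ioo 0 L, ThinFilm.chi φ (√ε) (g T x)| ≤ C * √(T * ε)) ∧
    (∀ T : ℝ, 0 < T → ∀ ε : ℕ → ℝ, (∀ k, 0 < ε k ∧ ε k ≤ 1) → Tendsto ε atTop (𝓝 0) →
      ∀ F G : ℕ → ℝ → ℝ → ℝ,
      (∀ k, ThinFilm.IsRegularizedSolution L R μ (ε k) f₀ g₀ (F k) (G k)) →
      ∀ f g : ℝ × ℝ → ℝ,
      TendstoUniformlyOn (fun k p => F k p.1 p.2) f atTop (Icc 0 T ×ˢ Icc 0 L) →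
      TendstoUniformlyOn (fun k p => G k p.1 p.2) g atTop (Icc 0 T ×ˢ Icc 0 L) →
      ∀ p ∈ Icc 0 T ×ˢ Icc 0 L, 0 ≤ f p ∧ 0 ≤ g p) :=
  ⟨ThinFilm.exists_abs_integral_chi_le hL hR hμ hφ hφ0 hφs hf₀ hg₀,
    fun _ hT _ hε hε0 _ _ hs _ _ hF hG => ThinFilm.nonneg_of_tendstoUniformlyOn hL hR hμ hφ hφ0
      hφs hφ1 hf₀ hg₀ hT hε hε0 hs hF hG⟩

theorem lemma2p2 (L R μ : ℝ) (hL : 0 < L) (hR : 0 < R) (hμ : 0 < μ)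
    (φ : ℝ → ℝ) (hφ : ContDiff ℝ ∞ φ) (hφ0 : ∀ x, 0 ≤ φ x)
    (hφs : tsupport φ ⊆ Icc (-1) 0) (hφ1 : ∫ x, φ x = 1)
    (f₀ g₀ : ℝ → ℝ) (hf₀ : ThinFilm.MemH L 1 f₀) (hg₀ : ThinFilm.MemH L 1 g₀)
    (hf₀0 : ∀ᵐ x ∂ThinFilm.vol L, 0 ≤ f₀ x) (hg₀0 : ∀ᵐ x ∂ThinFilm.vol L, 0 ≤ g₀ x) :
    (∃ C : ℝ, ∀ ε : ℝ, 0 < ε → ε ≤ 1 → ∀ f g : ℝ → ℝ → ℝ,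
      ThinFilm.IsRegularizedSolution L R μ ε f₀ g₀ f g → ∀ T : ℝ, 0 ≤ T →
        |∫ x in Ioo 0 L, ThinFilm.chi φ (√ε) (f T x)| ≤ C * √T * ε ∧
        |∫ x in Ioo 0 L, ThinFilm.chi φ (√ε) (g T x)| ≤ C * √(T * ε)) ∧
    (∀ T : ℝ, 0 < T → ∀ ε : ℕ → ℝ, (∀ k, 0 < ε k ∧ ε k ≤ 1) → Tendsto ε atTop (𝓝 0) →
      ∀ F G : ℕ → ℝ → ℝ → ℝ,
      (∀ k, ThinFilm.IsRegularizedSolution L R μ (ε k) f₀ g₀ (F k) (G k)) →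
      ∀ f g : ℝ × ℝ → ℝ,
      ContinuousOn f (Icc 0 T ×ˢ Icc 0 L) → ContinuousOn g (Icc 0 T ×ˢ Icc 0 L) →
      TendstoUniformlyOn (fun k p => F k p.1 p.2) f atTop (Icc 0 T ×ˢ Icc 0 L) →
      TendstoUniformlyOn (fun k p => G k p.1 p.2) g atTop (Icc 0 T ×ˢ Icc 0 L) →
      ∀ p ∈ Icc 0 T ×ˢ Icc 0 L, 0 ≤ f p ∧ 0 ≤ g p) :=
  let ⟨hbound, hnonneg⟩ :=
    lemma2p2_general L R μ hL hR hμ.le φ hφ.continuous hφ0 hφs hφ1 f₀ g₀ hf₀0 hg₀0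
  ⟨hbound, fun T hT ε hε hε0 F G hs f g _ _ => hnonneg T hT ε hε hε0 F G hs f g⟩
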